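/- Let $q>3$ be a power of an odd prime and let $n\ge 2$. For an involution $i$ of a finite group $G$ and $g\in G$ write $i^g=g^{-1}ig$. Define $\zeta^i_0(g)$ to be the unique involution of the cyclic group $\langle ii^g\rangle$ if $ii^g$ has even order, and $\zeta^i_0(g)=1$ if $ii^g$ has odd order, and let $\heartsuit_i(G)=\langle \zeta^i_0(g)\mid g\in G\rangle$. An involution of $\mathrm{Sp}_{2n}(q)$ is of type $t_1$ if its $(-1)$-eigenspace on the natural module $\mathbb F_q^{2n}$ has dimension $2$ or $2n-2$; an involution of $\mathrm{PSp}_{2n}(q)=\mathrm{Sp}_{2n}(q)/Z(\mathrm{Sp}_{2n}(q))$ is of type $t_1$ if it is the image of an involution of type $t_1$ of $\mathrm{Sp}_{2n}(q)$. The semisimple socle $E(X)$ of a finite group $X$ is the subgroup generated by its subnormal quasisimple subgroups. Let $G\cong \mathrm{Sp}_{2n}(q)$ or $G\cong\mathrm{PSp}_{2n}(q)$, and let $i\in G$ be an involution of type $t_1$ (that is, one that corresponds under the given isomorphism to an involution of type $t_1$). (a) If $n\ge 3$ (for either group), then the derived subgroup satisfies $\heartsuit_i(G)'\cong \mathrm{Sp}_{2n-2}(q)$.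 (b) If $G\cong \mathrm{Sp}_4(q)$, then $\heartsuit_i(G)=Z(G)$. (c) If $G\cong \mathrm{PSp}_4(q)$, then $\heartsuit_i(G)\ge E(C_G(i))$. -/

import Mathlib

/-- The symplectic group `Sp_{2n}(F)`, as Mathlib's group of symplectic `2n × 2n` matrices. -/
abbrev Sp2n (n : ℕ) (F : Type*) [Field F] : Type _ :=
  Matrix.symplecticGroup (Fin n) F

/-- The projective symplectic group `PSp_{2n}(F) = Sp_{2n}(F) / Z(Sp_{2n}(F))`. -/
abbrev PSp2n (n : ℕ) (F : Type*) [Field F] : Type _ :=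
  Sp2n n F ⧸ Subgroup.center (Sp2n n F)

/-- An involution of `Sp_{2n}(F)` is of type `t_1` if its `(-1)`-eigenspace on the natural
`2n`-dimensional module has dimension `2` or `2n - 2`. -/
def Sp2n.IsTypeT1 {n : ℕ} {F : Type*} [Field F] (i : Sp2n n F) : Prop :=
  orderOf i = 2 ∧
    (Module.finrank F
        (Module.End.eigenspace
          (Matrix.toLin' (i : Matrix (Fin n ⊕ Fin n) (Fin n ⊕ Fin n) F)) (-1)) = 2 ∨
      Module.finrank F
        (Module.End.eigenspace
          (Matrix.toLin' (i : Matrix (Fin n ⊕ Fin n) (Fin n ⊕ Fin n) F)) (-1)) = 2 * n - 2)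

/-- An involution of `PSp_{2n}(F)` is of type `t_1` if it is the image of an involution of
`Sp_{2n}(F)` of type `t_1`. -/
def PSp2n.IsTypeT1 {n : ℕ} {F : Type*} [Field F] (i : PSp2n n F) : Prop :=
  orderOf i = 2 ∧
    ∃ j : Sp2n n F, Sp2n.IsTypeT1 j ∧ (QuotientGroup.mk j : PSp2n n F) = i

/-- The involution `i(x)` obtained from an element `x` of (finite) even order: the last
non-identity element of the sequence `x ^ m, x ^ (2 m), x ^ (4 m), …`, where `2 ^ k * m` with
`m` odd is an exponent of the group. This is the unique involution of the cyclic group `⟨x⟩`,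
that is, `x ^ (o(x) / 2)`. -/
noncomputable def producedInvolution {G : Type*} [Group G] (x : G) : G :=
  x ^ (orderOf x / 2)

/-- The map `ζ₀^i`: with `i ^ g = g⁻¹ i g`, it sends `g` to the involution produced from
`i * i ^ g` when this product has even order, and to `1` when it has odd order. -/
noncomputable def zetaZero {G : Type*} [Group G] (i g : G) : G :=
  open Classical in
  if Even (orderOf (i * (g⁻¹ * i * g))) then producedInvolution (i * (g⁻¹ * i * g)) else 1

/-- The heart `♥_i(G)`: the subgroup generated by all `ζ₀^i(g)`, `g ∈ G`. -/
def heart {G : Type*} [Group G] (i : G) : Subgroup G :=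
  Subgroup.closure (Set.range (zetaZero i))

/-- A group is quasisimple if it is perfect and simple modulo its center. -/
def IsQuasisimpleGroup (L : Type*) [Group L] : Prop :=
  Group.IsPerfect L ∧ IsSimpleGroup (L ⧸ Subgroup.center L)

/-- The semisimple socle `E(X)` (the layer) of a group `X`: the subgroup generated by the
components of `X`, i.e. by its subnormal quasisimple subgroups. -/
def semisimpleSocle (X : Type*) [Group X] : Subgroup X :=
  sSup {L : Subgroup X | L.IsSubnormal ∧ IsQuasisimpleGroup L}

/-!
The symplectic group is treated as the isometry group of a symplectic form `ω` on a space `V`.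
Up to the sign `-1`, which does not change the heart, an involution of type `t_1` is an involution
`t` that is `-1` on a plane `W = ⟨e, f⟩` with `ω(e, f) = 1` and `1` on `U = W^⊥`.

*Upper bound.* An element `z = ζ₀(g)` satisfies `z² = 1` and commutes with `t`, because `t` inverts
`t * t ^ g`. So `z` preserves `W`, and it acts there as `±1`, since `-1` is the only involution of
`SL₂` (`apply_eq_or_of_commute_planeInv`). Hence commutators in the heart act trivially on `W`. In
dimension four `z` acts as a scalar on `U` too, and `z = ± t` is impossible because `t` is not
central (`mem_center_of_zetaZero_mul_mem`), so the heart is central.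

*Lower bound.* Let `(e', f')` be a hyperbolic pair of `U`. The quarter turn
`e ↦ e' ↦ -e`, `f ↦ f' ↦ -f` is the product of `t` and a conjugate of `t` (`quarterTurn_eq`), and
its square is `-1` on `W ⊥ ⟨e', f'⟩` and `1` on the complement of this sum. These squares therefore
lie in the heart; in dimension four this gives `-1`, and modulo scalars the quarter turns
themselves lie in the heart. In either situation products of two such elements scale a given
vector `u` of `U` by some `μ` with `μ² ≠ 1`, which is where `q > 3` enters. If `k u = μ u`,
then the commutator of `k` with the transvection `τ` along `u` with parameter `a` is the
transvection along `u` with parameter `(μ² - 1) a`. As the heart is normalized by the centralizer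
of `t`, it contains all transvections along vectors of `U`, and in large dimension so does its
derived subgroup. These transvections generate the pointwise stabilizer of `W`
(`mem_of_transvection_mem`), which is isomorphic to `Sp(U)` (`nonempty_fixer_equiv`).

*Quotient by scalars.* In dimension at least five `t * t ^ g` fixes a nonzero vector, so its order
does not change modulo `±1` and the heart of the image is the image of the heart
(`map_heart_planeInv`). In dimension four the transvection argument, applied to `W` and to `U`,
shows that the heart contains the image of the centralizer of `t`. An element of the centralizer
of the image of `t` lifts to an isometry that maps `t` to `± t`, so the derived subgroup of this
centralizer, and with it every perfect subgroup, lies in the heart (`semisimpleSocle_le_heart`).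
-/

open Module

/-! ### Symplectic forms, isometry groups and transvections -/

section Forms

variable {F V : Type*} [Field F] [AddCommGroup V] [Module F V]

/-- A symplectic form: an alternating bilinear form with trivial radical. -/
structure IsSymplecticForm (ω : LinearMap.BilinForm F V) : Prop where
  alt : ω.IsAlt
  eq_zero : ∀ x, (∀ y, ω x y = 0) → x = 0

/-- The isometry group `Sp(V, ω)` of a bilinear form, as a group of linear automorphisms. -/
def isometryGroup (ω : LinearMap.BilinForm F V) : Subgroup (V ≃ₗ[F] V) where
  carrier := {g | ∀ x y, ω (g x) (g y) = ω x y}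
  mul_mem' {a b} ha hb x y := (ha _ _).trans (hb x y)
  one_mem' _ _ := rfl
  inv_mem' {a} ha x y := by
    have h := ha (a⁻¹ x) (a⁻¹ y)
    have h1 : ∀ z, a (a⁻¹ z) = z := a.apply_symm_apply
    rw [h1, h1] at h
    exact h.symm

variable {ω : LinearMap.BilinForm F V}

namespace isometryGroup

theorem ext {g h : isometryGroup ω} (H : ∀ x, g.1 x = h.1 x) : g = h :=
  Subtype.ext (LinearEquiv.ext H)

theorem isom (g : isometryGroup ω) (x y : V) : ω (g.1 x) (g.1 y) = ω x y := g.2 x y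

theorem mul_apply (g h : isometryGroup ω) (x : V) : (g * h).1 x = g.1 (h.1 x) := rfl

theorem one_apply (x : V) : (1 : isometryGroup ω).1 x = x := rfl

theorem apply_inv_apply (g : isometryGroup ω) (x : V) : g.1 (g⁻¹.1 x) = x := by
  rw [← mul_apply, mul_inv_cancel, one_apply]

theorem inv_apply_apply (g : isometryGroup ω) (x : V) : g⁻¹.1 (g.1 x) = x := by
  rw [← mul_apply, inv_mul_cancel, one_apply]

variable (ω) in
/-- The scalar `-1`. -/
def negOne : isometryGroup ω :=
  ⟨LinearEquiv.neg F, fun x y => by simp⟩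

@[simp] theorem negOne_apply (x : V) : (negOne ω).1 x = -x := rfl

theorem negOne_comm (g : isometryGroup ω) : negOne ω * g = g * negOne ω :=
  ext fun x => by simp

theorem negOne_mul_self : negOne ω * negOne ω = 1 :=
  ext fun x => by simp

end isometryGroup

namespace IsSymplecticForm

open isometryGroup

theorem swap (h : IsSymplecticForm ω) (x y : V) : ω x y = -ω y x :=
  (LinearMap.BilinForm.IsAlt.neg_eq h.alt y x).symm

theorem self (h : IsSymplecticForm ω) (x : V) : ω x x = 0 := h.alt x

theorem exists_eq_one (h : IsSymplecticForm ω) {x : V} (hx : x ≠ 0) : ∃ y, ω x y = 1 := by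
  by_contra! hy
  refine hx (h.eq_zero x fun y => ?_)
  by_contra hxy
  exact hy ((ω x y)⁻¹ • y) (by simp [hxy])

/-- The subspace of fixed vectors of an isometry. -/
def fixedSpace (g : isometryGroup ω) : Submodule F V :=
  LinearMap.ker (g.1.toLinearMap - LinearMap.id)

theorem mem_fixedSpace {g : isometryGroup ω} {x : V} : x ∈ fixedSpace g ↔ g.1 x = x := by
  simp [fixedSpace, sub_eq_zero]

variable [FiniteDimensional F V]

/-- A linear map preserving a symplectic form of finite dimension, as an element of the
isometry group. -/
noncomputable def mkIsom (h : IsSymplecticForm ω) (g : V →ₗ[F] V)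
    (hg : ∀ x y, ω (g x) (g y) = ω x y) : isometryGroup ω :=
  ⟨LinearEquiv.ofInjectiveEndo g (by
    rw [← LinearMap.ker_eq_bot, LinearMap.ker_eq_bot']
    intro x hx
    refine h.eq_zero x fun y => ?_
    rw [← hg, hx]
    simp), hg⟩

@[simp] theorem mkIsom_apply (h : IsSymplecticForm ω) (g : V →ₗ[F] V)
    (hg : ∀ x y, ω (g x) (g y) = ω x y) (x : V) : (h.mkIsom g hg).1 x = g x := rfl

/-- The symplectic transvection `x ↦ x + a ω(u, x) u`. -/
noncomputable def transvection (h : IsSymplecticForm ω) (u : V) (a : F) : isometryGroup ω :=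
  h.mkIsom (LinearMap.id + (a • ω u).smulRight u) fun x y => by
    simp [h.self, h.swap x u]
    ring

theorem transvection_apply (h : IsSymplecticForm ω) (u : V) (a : F) (x : V) :
    (h.transvection u a).1 x = x + (a * ω u x) • u := rfl

theorem transvection_mul (h : IsSymplecticForm ω) (u : V) (a b : F) :
    h.transvection u a * h.transvection u b = h.transvection u (a + b) :=
  isometryGroup.ext fun x => by
    simp only [mul_apply, transvection_apply, map_add, map_smul, h.self]
    module

theorem transvection_zero (h : IsSymplecticForm ω) (u : V) : h.transvection u 0 = 1 :=
  isometryGroup.ext fun x => by simp [transvection_apply]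

theorem transvection_inv (h : IsSymplecticForm ω) (u : V) (a : F) :
    (h.transvection u a)⁻¹ = h.transvection u (-a) := by
  rw [inv_eq_iff_mul_eq_one, transvection_mul, add_neg_cancel, transvection_zero]

theorem conj_transvection (h : IsSymplecticForm ω) (g : isometryGroup ω) (u : V) (a : F) :
    g * h.transvection u a * g⁻¹ = h.transvection (g.1 u) a := by
  rw [mul_inv_eq_iff_eq_mul]
  exact isometryGroup.ext fun x => by
    simp only [mul_apply, transvection_apply, map_add, map_smul, isom]

theorem transvection_smul (h : IsSymplecticForm ω) (u : V) (c a : F) :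
    h.transvection (c • u) a = h.transvection u (c ^ 2 * a) :=
  isometryGroup.ext fun x => by
    simp only [transvection_apply, map_smul, LinearMap.smul_apply, smul_eq_mul]
    module

/-- If `k` scales `u` by `μ`, its commutator with a transvection along `u` is again a
transvection along `u`. -/
theorem commutator_transvection (h : IsSymplecticForm ω) {k : isometryGroup ω} {u : V} {μ : F}
    (hk : k.1 u = μ • u) (a : F) :
    k * h.transvection u a * k⁻¹ * (h.transvection u a)⁻¹ =
      h.transvection u ((μ ^ 2 - 1) * a) := by
  rw [conj_transvection, hk, transvection_smul, transvection_inv, transvection_mul]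
  congr 1
  ring

/-- An isometry fixing a set `W` pointwise is a product of transvections that fix `W`
pointwise. -/
theorem mem_of_transvection_mem (h : IsSymplecticForm ω) (W : Set V)
    (H : Subgroup (isometryGroup ω))
    (hH : ∀ u, (∀ w ∈ W, ω u w = 0) → ∀ a, h.transvection u a ∈ H)
    (g : isometryGroup ω) (hg : ∀ w ∈ W, g.1 w = w) : g ∈ H := by
  suffices key : ∀ (m : ℕ) (g : isometryGroup ω), (∀ w ∈ W, g.1 w = w) →
      finrank F V ≤ finrank F (fixedSpace g) + m → g ∈ H from
    key _ g hg (Nat.le_add_left _ _)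
  -- a displacement `g v - v` is orthogonal to every fixed vector
  have orth : ∀ (g : isometryGroup ω) (v x : V), g.1 x = x → ω (g.1 v - v) x = 0 := by
    intro g v x hx
    have := isom g v x
    rw [hx] at this
    simp [this]
  intro m
  induction m with
  | zero =>
    intro g _ hm
    have htop : fixedSpace g = ⊤ := Submodule.eq_top_of_finrank_eq
      (le_antisymm (Submodule.finrank_le _) (by simpa using hm))
    have : g = 1 := isometryGroup.ext fun x =>
      mem_fixedSpace.1 (htop ▸ Submodule.mem_top)
    exact this ▸ H.one_mem
  | succ m ih =>
    -- if `ω (v, g v) ≠ 0`, a transvection along `g v - v` moves `v` to `g v`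
    have good : ∀ g : isometryGroup ω, (∀ w ∈ W, g.1 w = w) →
        finrank F V ≤ finrank F (fixedSpace g) + (m + 1) → ∀ v, ω v (g.1 v) ≠ 0 → g ∈ H := by
      intro g hg hm v hv
      set u := g.1 v - v with hu
      set T := h.transvection u (ω v (g.1 v))⁻¹ with hT
      have hTH : T ∈ H := hH u (fun w hw => orth g v w (hg w hw)) _
      have hfix : ∀ x, g.1 x = x → (T * g).1 x = x := by
        intro x hx
        rw [mul_apply, hx, hT, transvection_apply, orth g v x hx]
        simp
      have hTv : (T * g).1 v = v := by
        have h1 : ω u (g.1 v) = -ω v (g.1 v) := by simp [hu, h.self]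
        have h2 : (ω v (g.1 v))⁻¹ * -ω v (g.1 v) = -1 := by field_simp
        rw [mul_apply, hT, transvection_apply, h1, h2, hu]
        module
      have hlt : fixedSpace g < fixedSpace (T * g) := by
        refine lt_of_le_of_ne (fun x hx => mem_fixedSpace.2 (hfix x (mem_fixedSpace.1 hx))) ?_
        intro heq
        have : v ∈ fixedSpace g := heq ▸ mem_fixedSpace.2 hTv
        rw [mem_fixedSpace] at this
        exact hv (by rw [this, h.self])
      have := Submodule.finrank_lt_finrank_of_lt hlt
      have hTg := ih (T * g) (fun w hw => hfix w (hg w hw)) (by omega)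
      exact (H.mul_mem_cancel_left hTH).1 hTg
    intro g hg hm
    by_cases hgood : ∃ v, ω v (g.1 v) ≠ 0
    · obtain ⟨v, hv⟩ := hgood
      exact good g hg hm v hv
    by_cases hone : ∃ v, g.1 v ≠ v
    swap
    · push Not at hone
      have : g = 1 := isometryGroup.ext hone
      exact this ▸ H.one_mem
    push Not at hgood
    obtain ⟨v, hv⟩ := hone
    -- otherwise a transvection along a displacement `u` brings `g` into the previous case
    set u := g.1 v - v with hu
    have hu0 : u ≠ 0 := sub_ne_zero.2 hv
    obtain ⟨y, hy⟩ := h.exists_eq_one hu0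
    obtain ⟨x, hx1, hx2⟩ : ∃ x, ω u x ≠ 0 ∧ ω u (g.1 x) ≠ 0 := by
      by_cases h1 : ω u (g.1 y) = 0
      · by_cases h2 : ω u (g⁻¹.1 y) = 0
        · exact ⟨y + g⁻¹.1 y, by rw [map_add, h2, hy]; simp,
            by rw [map_add, map_add, h1, apply_inv_apply, hy]; simp⟩
        · exact ⟨g⁻¹.1 y, h2, by rw [apply_inv_apply, hy]; exact one_ne_zero⟩
      · exact ⟨y, by simp [hy], h1⟩
    set T := h.transvection u 1 with hT
    have hTH : T ∈ H := hH u (fun w hw => orth g v w (hg w hw)) _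
    have hfix : ∀ x, g.1 x = x → (T * g).1 x = x := by
      intro x hx
      rw [mul_apply, hx, hT, transvection_apply, orth g v x hx]
      simp
    have hle : fixedSpace g ≤ fixedSpace (T * g) :=
      fun x hx => mem_fixedSpace.2 (hfix x (mem_fixedSpace.1 hx))
    have := Submodule.finrank_mono hle
    have hTg := good (T * g) (fun w hw => hfix w (hg w hw)) (by omega) x (by
      rw [mul_apply, hT, transvection_apply, map_add, hgood, h.swap _ (_ • u)]
      simp [hx1, hx2])
    exact (H.mul_mem_cancel_left hTH).1 hTg

end IsSymplecticForm

end Forms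

/-! ### Hyperbolic pairs, plane involutions and quarter turns -/

section Frames

variable {F V : Type*} [Field F] [AddCommGroup V] [Module F V] {ω : LinearMap.BilinForm F V}

variable (ω) in
/-- For a hyperbolic pair `ω(e, f) = 1`, the linear map sending `e` to `a` and `f` to `b` and
vanishing on the orthogonal complement of `⟨e, f⟩`. -/
def planeMap (e f a b : V) : V →ₗ[F] V :=
  (ω.flip f).smulRight a - (ω.flip e).smulRight b

theorem planeMap_apply (e f a b x : V) : planeMap ω e f a b x = ω x f • a - ω x e • b := rfl

variable (ω) in
/-- For a hyperbolic pair `ω(e, f) = 1`, the orthogonal projection onto the plane `⟨e, f⟩`. -/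
def planeProj (e f : V) : V →ₗ[F] V :=
  planeMap ω e f e f

theorem planeProj_apply (e f x : V) : planeProj ω e f x = ω x f • e - ω x e • f := rfl

variable (ω) in
/-- Two mutually orthogonal hyperbolic pairs `(e, f)` and `(e', f')`. -/
structure IsHyperbolicFrame (e f e' f' : V) : Prop where
  ef : ω e f = 1
  ef' : ω e' f' = 1
  e_e' : ω e e' = 0
  e_f' : ω e f' = 0
  f_e' : ω f e' = 0
  f_f' : ω f f' = 0

namespace IsSymplecticForm

open isometryGroup

theorem exists_ne_zero_orthogonal [FiniteDimensional F V] {ι : Type*} [Fintype ι] (v : ι → V)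
    (hι : Fintype.card ι < finrank F V) : ∃ x : V, x ≠ 0 ∧ ∀ i, ω x (v i) = 0 := by
  have hk : LinearMap.ker (LinearMap.pi fun i => ω.flip (v i)) ≠ ⊥ :=
    LinearMap.ker_ne_bot_of_finrank_lt (by simpa using hι)
  obtain ⟨x, hx, hx0⟩ := Submodule.exists_mem_ne_zero_of_ne_bot hk
  exact ⟨x, hx0, fun i => congrFun (LinearMap.mem_ker.1 hx) i⟩

theorem frame_symm (h : IsSymplecticForm ω) {e f e' f' : V} (H : IsHyperbolicFrame ω e f e' f') :
    IsHyperbolicFrame ω e' f' e f where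
  ef := H.ef'
  ef' := H.ef
  e_e' := by rw [h.swap, H.e_e', neg_zero]
  e_f' := by rw [h.swap, H.f_e', neg_zero]
  f_e' := by rw [h.swap, H.e_f', neg_zero]
  f_f' := by rw [h.swap, H.f_f', neg_zero]

/-- A nonzero vector orthogonal to a hyperbolic pair is the first vector of a second one. -/
theorem exists_frame (h : IsSymplecticForm ω) {e f u : V} (hef : ω e f = 1) (hu : u ≠ 0)
    (he : ω u e = 0) (hf : ω u f = 0) : ∃ v, IsHyperbolicFrame ω e f u v := by
  obtain ⟨y, hy⟩ := h.exists_eq_one hu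
  have hfe : ω f e = -1 := by rw [h.swap, hef]
  refine ⟨y - planeProj ω e f y, hef, ?_, ?_, ?_, ?_, ?_⟩
  · simp [planeProj_apply, he, hf, hy]
  · rw [h.swap, he, neg_zero]
  · simp [planeProj_apply, hef, h.self, h.swap e y]
  · rw [h.swap, hf, neg_zero]
  · simp [planeProj_apply, hfe, h.self, h.swap f y]

/-- A nonzero vector orthogonal to a frame is the first vector of a third hyperbolic pair. -/
theorem exists_frame_of_frame (h : IsSymplecticForm ω) {e f e' f' u : V}
    (H : IsHyperbolicFrame ω e f e' f') (hu : u ≠ 0)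
    (he : ω u e = 0) (hf : ω u f = 0) (he' : ω u e' = 0) (hf' : ω u f' = 0) :
    ∃ v, IsHyperbolicFrame ω e f u v ∧ IsHyperbolicFrame ω e' f' u v := by
  obtain ⟨v, hv⟩ := h.exists_frame H.ef hu he hf
  have h1 : ω f' e' = -1 := by rw [h.swap, H.ef']
  refine ⟨v - planeProj ω e' f' v, ⟨H.ef, ?_, hv.e_e', ?_, hv.f_e', ?_⟩,
    ⟨H.ef', ?_, ?_, ?_, ?_, ?_⟩⟩
  · simp [planeProj_apply, he', hf', hv.ef']
  · simp [planeProj_apply, hv.e_f', H.e_e', H.e_f']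
  · simp [planeProj_apply, hv.f_f', H.f_e', H.f_f']
  · simp [planeProj_apply, he', hf', hv.ef']
  · rw [h.swap, he', neg_zero]
  · simp [planeProj_apply, H.ef', h.self, h.swap e' v]
  · rw [h.swap, hf', neg_zero]
  · simp [planeProj_apply, h1, h.self, h.swap f' v]

/-- In dimension four a frame is a basis. -/
theorem eq_proj_add_proj [FiniteDimensional F V] (h : IsSymplecticForm ω) {e f e' f' : V}
    (H : IsHyperbolicFrame ω e f e' f') (hV : finrank F V = 4) (x : V) :
    x = planeProj ω e f x + planeProj ω e' f' x := by
  have H' := h.frame_symm H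
  have h1 : ω f e = -1 := by rw [h.swap, H.ef]
  have h2 : ω f' e' = -1 := by rw [h.swap, H.ef']
  set L : V →ₗ[F] (Fin 4 → F) := LinearMap.pi ![ω.flip e, ω.flip f, ω.flip e', ω.flip f'] with hL
  have hLx : ∀ x, L x = ![ω x e, ω x f, ω x e', ω x f'] := by
    intro x
    ext i
    fin_cases i <;> rfl
  have hinj : Function.Injective L := by
    refine (LinearMap.injective_iff_surjective_of_finrank_eq_finrank (by simp [hV])).2 ?_
    intro c
    refine ⟨c 1 • e - c 0 • f + (c 3 • e' - c 2 • f'), ?_⟩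
    rw [hLx]
    ext i
    fin_cases i <;>
      simp [h1, h2, H.ef, H.ef', h.self, H.e_e', H.e_f', H.f_e', H.f_f', H'.e_e', H'.e_f',
        H'.f_e', H'.f_f']
  apply hinj
  rw [hLx, hLx]
  ext i
  fin_cases i <;>
    simp [planeProj_apply, h1, h2, H.ef, H.ef', h.self, H.e_e', H.e_f', H.f_e', H.f_f', H'.e_e',
      H'.e_f', H'.f_e', H'.f_f']

variable [FiniteDimensional F V]

/-- The involution that is `-1` on the plane of a hyperbolic pair `(e, f)` and `1` on its
orthogonal complement. -/
noncomputable def planeInv (h : IsSymplecticForm ω) {e f : V} (hef : ω e f = 1) :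
    isometryGroup ω :=
  h.mkIsom (LinearMap.id - (2 : F) • planeProj ω e f) fun x y => by
    have h1 : ω f e = -1 := by rw [h.swap, hef]
    simp only [LinearMap.sub_apply, LinearMap.id_apply, LinearMap.smul_apply, planeProj_apply,
      map_sub, map_smul, smul_eq_mul, h.self, hef, h1, h.swap e y, h.swap f y]
    ring

theorem planeInv_apply (h : IsSymplecticForm ω) {e f : V} (hef : ω e f = 1) (x : V) :
    (h.planeInv hef).1 x = x - (2 : F) • planeProj ω e f x := rfl

theorem planeInv_fst (h : IsSymplecticForm ω) {e f : V} (hef : ω e f = 1) :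
    (h.planeInv hef).1 e = -e := by
  rw [planeInv_apply, planeProj_apply, hef, h.self]
  module

theorem planeInv_snd (h : IsSymplecticForm ω) {e f : V} (hef : ω e f = 1) :
    (h.planeInv hef).1 f = -f := by
  rw [planeInv_apply, planeProj_apply, h.self, h.swap, hef]
  module

theorem planeInv_of_orthogonal (h : IsSymplecticForm ω) {e f x : V} (hef : ω e f = 1)
    (he : ω x e = 0) (hf : ω x f = 0) : (h.planeInv hef).1 x = x := by
  rw [planeInv_apply, planeProj_apply, he, hf]
  module

theorem planeInv_mul_self (h : IsSymplecticForm ω) {e f : V} (hef : ω e f = 1) :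
    h.planeInv hef * h.planeInv hef = 1 :=
  isometryGroup.ext fun x => by
    rw [mul_apply, planeInv_apply h hef x, map_sub, map_smul, planeProj_apply, map_sub, map_smul,
      map_smul, planeInv_fst, planeInv_snd, planeInv_apply, planeProj_apply, one_apply]
    module

/-- An isometry fixing `e` and `f` commutes with the involution of the plane `⟨e, f⟩`. -/
theorem commute_planeInv (h : IsSymplecticForm ω) {e f : V} (hef : ω e f = 1)
    {g : isometryGroup ω} (he : g.1 e = e) (hf : g.1 f = f) :
    g * h.planeInv hef = h.planeInv hef * g :=
  isometryGroup.ext fun x => by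
    have h1 := isom g x e
    have h2 := isom g x f
    rw [he] at h1
    rw [hf] at h2
    simp only [mul_apply, planeInv_apply, planeProj_apply, map_sub, map_smul, he, hf, h1, h2]

/-- The quarter turn of a frame: `e ↦ e' ↦ -e`, `f ↦ f' ↦ -f`, and the identity on the
orthogonal complement of the frame. -/
noncomputable def quarterTurn (h : IsSymplecticForm ω) {e f e' f' : V}
    (H : IsHyperbolicFrame ω e f e' f') : isometryGroup ω :=
  h.mkIsom (LinearMap.id - planeProj ω e f - planeProj ω e' f' +
      planeMap ω e f e' f' - planeMap ω e' f' e f) fun x y => by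
    have H' := h.frame_symm H
    have h1 : ω f e = -1 := by rw [h.swap, H.ef]
    have h2 : ω f' e' = -1 := by rw [h.swap, H.ef']
    simp only [LinearMap.sub_apply, LinearMap.id_apply, planeProj_apply, LinearMap.add_apply,
      planeMap_apply, LinearMap.smul_apply,
      map_sub, map_add, map_smul, smul_eq_mul, h.self, h1, h2, H.ef, H.ef', H.e_e', H.e_f',
      H.f_e', H.f_f', H'.e_e', H'.e_f', H'.f_e', H'.f_f', h.swap e y, h.swap f y, h.swap e' y,
      h.swap f' y]
    ring

theorem quarterTurn_apply (h : IsSymplecticForm ω) {e f e' f' : V}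
    (H : IsHyperbolicFrame ω e f e' f') (x : V) : (h.quarterTurn H).1 x =
      x - (ω x f • e - ω x e • f) - (ω x f' • e' - ω x e' • f') + (ω x f • e' - ω x e • f') -
        (ω x f' • e - ω x e' • f) := rfl

/-- An isometry sending `e, f, e', f'` to `e - e', (f - f') / 2, (e + e') / 2, f + f'`. -/
noncomputable def frameShear (h : IsSymplecticForm ω) {e f e' f' : V} (h2 : (2 : F) ≠ 0)
    (H : IsHyperbolicFrame ω e f e' f') : isometryGroup ω :=
  h.mkIsom (LinearMap.id - planeProj ω e f - planeProj ω e' f' +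
      planeMap ω e f (e - e') ((2 : F)⁻¹ • (f - f')) +
      planeMap ω e' f' ((2 : F)⁻¹ • (e + e')) (f + f'))
      fun x y => by
    have H' := h.frame_symm H
    have h3 : ω f e = -1 := by rw [h.swap, H.ef]
    have h4 : ω f' e' = -1 := by rw [h.swap, H.ef']
    simp only [LinearMap.sub_apply, LinearMap.id_apply, planeProj_apply, LinearMap.add_apply,
      planeMap_apply, LinearMap.smul_apply,
      map_sub, map_add, map_smul, smul_eq_mul, h.self, h3, h4, H.ef, H.ef', H.e_e', H.e_f',
      H.f_e', H.f_f', H'.e_e', H'.e_f', H'.f_e', H'.f_f', h.swap e y, h.swap f y, h.swap e' y,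
      h.swap f' y]
    field_simp
    ring

theorem frameShear_apply (h : IsSymplecticForm ω) {e f e' f' : V} (h2 : (2 : F) ≠ 0)
    (H : IsHyperbolicFrame ω e f e' f') (x : V) : (h.frameShear h2 H).1 x =
      x - (ω x f • e - ω x e • f) - (ω x f' • e' - ω x e' • f') +
        (ω x f • (e - e') - ω x e • ((2 : F)⁻¹ • (f - f'))) +
        (ω x f' • ((2 : F)⁻¹ • (e + e')) - ω x e' • (f + f')) := rfl

section

variable (h : IsSymplecticForm ω) {e f e' f' : V} (H : IsHyperbolicFrame ω e f e' f')
include h H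

theorem quarterTurn_e : (h.quarterTurn H).1 e = e' := by
  simp only [quarterTurn_apply, h.self, H.ef, H.e_e', H.e_f']
  module

theorem quarterTurn_e' : (h.quarterTurn H).1 e' = -e := by
  have H' := h.frame_symm H
  simp only [quarterTurn_apply, h.self, H.ef', H'.e_e', H'.e_f']
  module

theorem quarterTurn_f : (h.quarterTurn H).1 f = f' := by
  simp only [quarterTurn_apply, h.self, h.swap f e, H.ef, H.f_e', H.f_f']
  module

theorem quarterTurn_f' : (h.quarterTurn H).1 f' = -f := by
  have H' := h.frame_symm H
  simp only [quarterTurn_apply, h.self, h.swap f' e', H.ef', H'.f_e', H'.f_f']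
  module

theorem quarterTurn_sq :
    h.quarterTurn H * h.quarterTurn H = h.planeInv H.ef * h.planeInv H.ef' :=
  isometryGroup.ext fun x => by
    have H' := h.frame_symm H
    rw [mul_apply, mul_apply, planeInv_apply h H.ef' x, planeProj_apply,
      quarterTurn_apply h H x]
    simp only [map_sub, map_add, map_smul, quarterTurn_e, quarterTurn_e', quarterTurn_f,
      quarterTurn_f', planeInv_of_orthogonal h H.ef H'.e_e' H'.e_f',
      planeInv_of_orthogonal h H.ef H'.f_e' H'.f_f']
    rw [quarterTurn_apply, planeInv_apply, planeProj_apply]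
    module

/-- The quarter turn is the product of the involution `t` of the plane `⟨e, f⟩` and a conjugate
of `t`, namely the involution exchanging the two planes of the frame. -/
theorem quarterTurn_eq (h2 : (2 : F) ≠ 0) : ∃ g : isometryGroup ω,
    h.planeInv H.ef * (g⁻¹ * h.planeInv H.ef * g) = h.quarterTurn H := by
  refine ⟨(h.frameShear h2 H)⁻¹, ?_⟩
  set t := h.planeInv H.ef with ht
  set g := h.frameShear h2 H with hg
  have H' := h.frame_symm H
  have te : t.1 e = -e := h.planeInv_fst H.ef
  have tf : t.1 f = -f := h.planeInv_snd H.ef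
  have te' : t.1 e' = e' := planeInv_of_orthogonal h H.ef H'.e_e' H'.e_f'
  have tf' : t.1 f' = f' := planeInv_of_orthogonal h H.ef H'.f_e' H'.f_f'
  have key : g * t = t * h.quarterTurn H * g := isometryGroup.ext fun x => by
    have hge : g.1 e = e - e' := by
      simp only [hg, frameShear_apply, h.self, H.ef, H.e_e', H.e_f']
      module
    have hgf : g.1 f = (2 : F)⁻¹ • (f - f') := by
      simp only [hg, frameShear_apply, h.self, h.swap f e, H.ef, H.f_e', H.f_f']
      module
    have hgx : g.1 x = x - (ω x f • e - ω x e • f) - (ω x f' • e' - ω x e' • f') +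
        (ω x f • (e - e') - ω x e • ((2 : F)⁻¹ • (f - f'))) +
        (ω x f' • ((2 : F)⁻¹ • (e + e')) - ω x e' • (f + f')) := rfl
    rw [mul_apply, mul_apply, mul_apply, planeInv_apply, planeProj_apply, hgx]
    simp only [map_sub, map_add, map_smul, quarterTurn_e, quarterTurn_e', quarterTurn_f,
      quarterTurn_f', map_neg, te, tf, te', tf', hge, hgf, hgx]
    rw [quarterTurn_apply]
    simp only [map_sub, map_add, map_smul, te, tf, te', tf']
    rw [planeInv_apply, planeProj_apply]
    match_scalars <;> field_simp <;> ring
  rw [inv_inv, key, mul_inv_cancel_right, ← mul_assoc, planeInv_mul_self, one_mul]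

end

/-- An isometry of order two that commutes with the involution of a plane acts on this plane as
a scalar `±1`, since `-1` is the only involution of `SL₂`. -/
theorem apply_eq_or_of_commute_planeInv (h : IsSymplecticForm ω) (h2 : (2 : F) ≠ 0) {e f : V}
    (hef : ω e f = 1) {z : isometryGroup ω} (hz : z * z = 1)
    (hc : h.planeInv hef * z = z * h.planeInv hef) :
    (z.1 e = e ∧ z.1 f = f) ∨ (z.1 e = -e ∧ z.1 f = -f) := by
  have key : ∀ x, (h.planeInv hef).1 x = -x → z.1 x = ω (z.1 x) f • e - ω (z.1 x) e • f := by
    intro x hx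
    have h1 : (h.planeInv hef).1 (z.1 x) = -z.1 x := by
      rw [← mul_apply, hc, mul_apply, hx, map_neg]
    rw [planeInv_apply, planeProj_apply] at h1
    have h3 : (2 : F) • (z.1 x - (ω (z.1 x) f • e - ω (z.1 x) e • f)) =
        z.1 x - (2 : F) • (ω (z.1 x) f • e - ω (z.1 x) e • f) + z.1 x := by
      module
    rw [h1, neg_add_cancel, smul_eq_zero_iff_right h2, sub_eq_zero] at h3
    exact h3
  have hzz : ∀ x, z.1 (z.1 x) = x := fun x => by rw [← mul_apply, hz, one_apply]
  have hzero : ∀ x, ω (z.1 x) x = 0 := by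
    intro x
    have h1 := isom z (z.1 x) x
    rw [hzz, h.swap] at h1
    have h3 : (2 : F) * ω (z.1 x) x = 0 := by linear_combination -h1
    exact (mul_eq_zero.1 h3).resolve_left h2
  have hze := key e (h.planeInv_fst hef)
  have hzf := key f (h.planeInv_snd hef)
  have hmove : ω (z.1 f) e = -ω (z.1 e) f := by
    rw [h.swap, ← isom z e, hzz]
  rw [hzero, zero_smul, sub_zero] at hze
  rw [hzero, hmove, zero_smul, zero_sub, neg_smul, neg_neg] at hzf
  have he0 : e ≠ 0 := by
    rintro rfl
    simp at hef
  have hsq : ω (z.1 e) f * ω (z.1 e) f = 1 := by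
    have h1 := hzz e
    rw [hze, map_smul, hze, smul_smul, map_smul, LinearMap.smul_apply, hef, smul_eq_mul,
      mul_one] at h1
    exact smul_left_injective F he0 (by simpa using h1)
  rcases mul_self_eq_one_iff.1 hsq with h1 | h1
  · left
    rw [hze, hzf, h1]
    simp
  · right
    rw [hze, hzf, h1]
    simp

end IsSymplecticForm

end Frames

/-! ### Hearts, and the heart of a plane involution -/

section Heart

variable {G K : Type*} [Group G] [Group K]

theorem zetaZero_eq_one_or (i g : G) : zetaZero i g = 1 ∨
    (Even (orderOf (i * (g⁻¹ * i * g))) ∧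
      zetaZero i g = (i * (g⁻¹ * i * g)) ^ (orderOf (i * (g⁻¹ * i * g)) / 2)) := by
  by_cases h : Even (orderOf (i * (g⁻¹ * i * g)))
  · right
    exact ⟨h, by rw [zetaZero, if_pos h]; rfl⟩
  · left
    rw [zetaZero, if_neg h]

theorem zetaZero_mul_self (i g : G) : zetaZero i g * zetaZero i g = 1 := by
  rcases zetaZero_eq_one_or i g with h | ⟨he, h⟩
  · rw [h, one_mul]
  · rw [h, ← pow_add, ← two_mul, Nat.two_mul_div_two_of_even he, pow_orderOf_eq_one]

/-- An involution inverts its product with a conjugate. -/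
theorem conj_mul_conj_eq_inv {i : G} (hi : i * i = 1) (g : G) :
    i * (i * (g⁻¹ * i * g)) * i⁻¹ = (i * (g⁻¹ * i * g))⁻¹ := by
  have hinv : i⁻¹ = i := inv_eq_of_mul_eq_one_left hi
  simp only [mul_inv_rev, inv_inv, hinv, ← mul_assoc, hi, one_mul]

theorem mul_zetaZero_comm {i : G} (hi : i * i = 1) (g : G) :
    i * zetaZero i g = zetaZero i g * i := by
  have hz := zetaZero_mul_self i g
  rw [← mul_inv_eq_iff_eq_mul]
  rcases zetaZero_eq_one_or i g with h | ⟨-, h⟩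
  · simp [h]
  · calc i * zetaZero i g * i⁻¹ = (zetaZero i g)⁻¹ := by
          rw [h, ← conj_pow, conj_mul_conj_eq_inv hi, inv_pow]
      _ = zetaZero i g := inv_eq_of_mul_eq_one_left hz

theorem zetaZero_mem_heart (i g : G) : zetaZero i g ∈ heart i :=
  Subgroup.subset_closure ⟨g, rfl⟩

/-- If the produced element and the involution agree modulo the center, then the involution
is central. -/
theorem mem_center_of_zetaZero_mul_mem {i g : G} (hi : i * i = 1)
    (h : zetaZero i g * i ∈ Subgroup.center G) : i ∈ Subgroup.center G := by
  have hinv : i⁻¹ = i := inv_eq_of_mul_eq_one_left hi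
  rcases zetaZero_eq_one_or i g with h1 | ⟨he, h1⟩
  · rwa [h1, one_mul] at h
  set x := i * (g⁻¹ * i * g) with hx
  -- `i` is a power of `x` up to a central factor, so it centralizes `x`, which it also inverts
  have hcomm : i * x = x * i := by
    have h2 : (zetaZero i g * i) * x = x * (zetaZero i g * i) :=
      ((Subgroup.mem_center_iff.1 h) x).symm
    have h3 : zetaZero i g * x = x * zetaZero i g := by
      rw [h1]
      exact (Commute.refl x).pow_left _
    rw [mul_assoc, ← mul_assoc x, ← h3, mul_assoc] at h2
    exact mul_left_cancel h2
  have hxx : x ^ 2 = 1 := by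
    have h2 := conj_mul_conj_eq_inv hi g
    rw [← hx, hcomm, mul_inv_cancel_right] at h2
    rw [sq]
    nth_rewrite 2 [h2]
    exact mul_inv_cancel x
  have ho : orderOf x = 2 := by
    have hd := orderOf_dvd_of_pow_eq_one hxx
    have hle := Nat.le_of_dvd two_pos hd
    have hpos := Nat.pos_of_dvd_of_pos hd two_pos
    obtain ⟨k, hk⟩ := he
    omega
  rw [ho, Nat.div_self two_pos, pow_one] at h1
  have h4 : zetaZero i g * i = g⁻¹ * i * g := by
    rw [h1, ← hcomm, hx, ← mul_assoc, hi, one_mul]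
  rw [h4] at h
  have h5 := Subgroup.Normal.conj_mem (inferInstance : (Subgroup.center G).Normal) _ h g
  simpa [mul_assoc] using h5

/-- A surjective homomorphism that preserves the orders of the products `i * i ^ g` carries the
heart onto the heart. -/
theorem map_heart (φ : G →* K) (hφ : Function.Surjective φ) (i : G)
    (ho : ∀ g, orderOf (φ (i * (g⁻¹ * i * g))) = orderOf (i * (g⁻¹ * i * g))) :
    (heart i).map φ = heart (φ i) := by
  have hz : ∀ g, φ (zetaZero i g) = zetaZero (φ i) (φ g) := by
    intro g
    have h1 : φ i * ((φ g)⁻¹ * φ i * φ g) = φ (i * (g⁻¹ * i * g)) := by simp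
    unfold zetaZero producedInvolution
    rw [h1, ho]
    split_ifs
    · rw [map_pow]
    · rw [map_one]
  rw [heart, MonoidHom.map_closure, heart, ← Set.range_comp]
  congr 1
  ext y
  constructor
  · rintro ⟨g, rfl⟩
    exact ⟨φ g, (hz g).symm⟩
  · rintro ⟨g, rfl⟩
    obtain ⟨g, rfl⟩ := hφ g
    exact ⟨g, hz g⟩

theorem map_heart_mulEquiv (φ : G ≃* K) (i : G) :
    (heart i).map φ.toMonoidHom = heart (φ i) :=
  map_heart φ.toMonoidHom φ.surjective i fun _ => φ.orderOf_eq _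

/-- The centralizer of an involution normalizes its heart. -/
theorem conj_mem_heart {i c h : G} (hc : c * i = i * c) (hh : h ∈ heart i) :
    c * h * c⁻¹ ∈ heart i := by
  have h1 := map_heart_mulEquiv (MulAut.conj c) i
  rw [MulAut.conj_apply, hc, mul_inv_cancel_right] at h1
  rw [← h1]
  exact ⟨h, hh, rfl⟩

theorem heart_central_mul {i c : G} (hc : c ∈ Subgroup.center G) (hcc : c * c = 1) :
    heart (c * i) = heart i := by
  have hcomm : ∀ g, g * c = c * g := fun g => Subgroup.mem_center_iff.1 hc g
  have h1 : ∀ g, c * i * (g⁻¹ * (c * i) * g) = i * (g⁻¹ * i * g) := by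
    intro g
    calc c * i * (g⁻¹ * (c * i) * g) = c * (i * ((g⁻¹ * c) * (i * g))) := by group
      _ = c * ((i * c) * (g⁻¹ * (i * g))) := by rw [hcomm g⁻¹]; group
      _ = c * c * (i * (g⁻¹ * i * g)) := by rw [hcomm i]; group
      _ = _ := by rw [hcc, one_mul]
  have h2 : zetaZero (c * i) = zetaZero i := by
    funext g
    unfold zetaZero
    rw [h1]
  rw [heart, heart, h2]

end Heart

namespace IsSymplecticForm

open isometryGroup

variable {F V : Type*} [Field F] [AddCommGroup V] [Module F V] {ω : LinearMap.BilinForm F V}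
  [FiniteDimensional F V]

theorem mem_center_iff (h : IsSymplecticForm ω) (h2 : (2 : F) ≠ 0) (g : isometryGroup ω) :
    g ∈ Subgroup.center (isometryGroup ω) ↔ g = 1 ∨ g = negOne ω := by
  constructor
  swap
  · rintro (rfl | rfl)
    · exact Subgroup.one_mem _
    · exact Subgroup.mem_center_iff.2 fun k => (negOne_comm k).symm
  intro hg
  -- commuting with the transvection along `u`, the isometry `g` preserves the line of `u`
  have hpm : ∀ u, g.1 u = u ∨ g.1 u = -u := by
    intro u
    by_cases hu : u = 0
    · simp [hu]
    obtain ⟨y, hy⟩ := h.exists_eq_one hu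
    have h1 := h.conj_transvection g u 1
    rw [← Subgroup.mem_center_iff.1 hg, mul_inv_cancel_right] at h1
    have h3 := congrArg (fun k : isometryGroup ω => k.1 y) h1
    simp only [transvection_apply, one_mul, hy, add_right_inj, one_smul] at h3
    set c := ω (g.1 u) y with hc
    have hcc : c * c = 1 := by
      have h4 := congrArg (fun v => ω v y) h3
      simpa [hy, ← hc, eq_comm] using h4
    rcases mul_self_eq_one_iff.1 hcc with h5 | h5
    · left
      rw [h5, one_smul] at h3
      exact h3.symm
    · right
      rw [h5] at h3
      nth_rewrite 2 [h3]
      simp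
  have hself : ∀ {x : V}, x = -x → x = 0 := by
    intro x hx
    have : (2 : F) • x = 0 := by rw [two_smul]; nth_rewrite 1 [hx]; simp
    exact (smul_eq_zero_iff_right h2).1 this
  by_cases hall : ∀ u, g.1 u = u
  · exact Or.inl (isometryGroup.ext hall)
  right
  push Not at hall
  obtain ⟨u, hu⟩ := hall
  have hu' := (hpm u).resolve_left hu
  refine isometryGroup.ext fun v => ?_
  rw [negOne_apply]
  rcases hpm v with hv | hv
  swap
  · exact hv
  have hu0 : u ≠ 0 := by
    rintro rfl
    simp at hu
  rcases hpm (u + v) with h5 | h5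
  · rw [map_add, hu', hv, add_left_inj] at h5
    exact absurd (hself h5.symm) hu0
  · rw [map_add, hu', hv, neg_add, add_right_inj] at h5
    rw [hv]
    exact h5

/-- A subgroup normalized by the transvections along `u`, and containing an isometry that scales
`u` by `μ` with `μ² ≠ 1`, contains the transvections along `u`. -/
theorem transvection_mem_of_normalizing (h : IsSymplecticForm ω)
    {H : Subgroup (isometryGroup ω)} {u : V} {μ : F} {k : isometryGroup ω} (hk : k ∈ H)
    (hku : k.1 u = μ • u) (hμ : μ ^ 2 ≠ 1)
    (hn : ∀ a, ∀ x ∈ H, h.transvection u a * x * (h.transvection u a)⁻¹ ∈ H) (b : F) :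
    h.transvection u b ∈ H := by
  have hb : (μ ^ 2 - 1) * ((μ ^ 2 - 1)⁻¹ * b) = b := mul_inv_cancel_left₀ (sub_ne_zero.2 hμ) b
  rw [← hb, ← h.commutator_transvection hku, mul_assoc k, mul_assoc k]
  exact H.mul_mem hk (hn _ _ (H.inv_mem hk))

theorem transvection_fixes (h : IsSymplecticForm ω) {u x : V} (hu : ω u x = 0) (a : F) :
    (h.transvection u a).1 x = x := by
  rw [transvection_apply, hu, mul_zero, zero_smul, add_zero]

theorem transvection_commute_planeInv (h : IsSymplecticForm ω) {e f u : V} (hef : ω e f = 1)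
    (he : ω u e = 0) (hf : ω u f = 0) (a : F) :
    h.transvection u a * h.planeInv hef = h.planeInv hef * h.transvection u a :=
  h.commute_planeInv hef (h.transvection_fixes he a) (h.transvection_fixes hf a)

/-- The product of the involutions of the two planes of a frame is the square of the quarter
turn of the frame, and hence is produced from the involution of the first plane. -/
theorem planeInv_mul_planeInv_mem_heart (h : IsSymplecticForm ω) (h2 : (2 : F) ≠ 0)
    {e f e' f' : V} (H : IsHyperbolicFrame ω e f e' f') :
    h.planeInv H.ef * h.planeInv H.ef' ∈ heart (h.planeInv H.ef) := by
  obtain ⟨g, hg⟩ := h.quarterTurn_eq H h2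
  have hsq := h.quarterTurn_sq H
  have he : ∀ x, (h.quarterTurn H * h.quarterTurn H).1 x =
      (h.planeInv H.ef).1 ((h.planeInv H.ef').1 x) := fun x => by rw [hsq, mul_apply]
  have H' := h.frame_symm H
  have hne : ¬h.quarterTurn H ^ 2 ^ 1 = 1 := by
    rw [pow_one, sq]
    intro h1
    have h3 := he e
    rw [h1, one_apply, h.planeInv_of_orthogonal H.ef' H.e_e' H.e_f', planeInv_fst] at h3
    have h4 : (2 : F) * ω e f = 0 := by
      have h5 := congrArg (fun v => ω v f) h3
      simp only [map_neg, LinearMap.neg_apply] at h5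
      linear_combination h5
    rw [H.ef, mul_one] at h4
    exact h2 h4
  have hcomm := h.commute_planeInv H.ef' (g := h.planeInv H.ef)
    (h.planeInv_of_orthogonal H.ef H'.e_e' H'.e_f')
    (h.planeInv_of_orthogonal H.ef H'.f_e' H'.f_f')
  have h4 : h.quarterTurn H ^ 2 ^ (1 + 1) = 1 := by
    have : (2 : ℕ) ^ (1 + 1) = 2 * 2 := by norm_num
    rw [this, pow_mul, sq, sq, hsq]
    nth_rewrite 1 [hcomm]
    rw [mul_assoc, ← mul_assoc (h.planeInv H.ef), planeInv_mul_self, one_mul, planeInv_mul_self]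
  have ho : orderOf (h.quarterTurn H) = 4 := by
    rw [orderOf_eq_prime_pow hne h4]
    norm_num
  have hz : zetaZero (h.planeInv H.ef) g = h.planeInv H.ef * h.planeInv H.ef' := by
    rw [zetaZero, hg, if_pos (by rw [ho]; decide), producedInvolution, ho, ← hsq, ← sq]
  exact hz ▸ zetaZero_mem_heart _ _

/-- The subgroup of isometries fixing two given vectors. -/
def fixer (ω : LinearMap.BilinForm F V) (e f : V) : Subgroup (isometryGroup ω) where
  carrier := {g | g.1 e = e ∧ g.1 f = f}
  mul_mem' {a b} ha hb := ⟨by rw [mul_apply, hb.1, ha.1], by rw [mul_apply, hb.2, ha.2]⟩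
  one_mem' := ⟨rfl, rfl⟩
  inv_mem' {a} ha :=
    ⟨by nth_rewrite 1 [← ha.1]; exact inv_apply_apply a e,
      by nth_rewrite 1 [← ha.2]; exact inv_apply_apply a f⟩

omit [FiniteDimensional F V] in
theorem mem_fixer {e f : V} {g : isometryGroup ω} :
    g ∈ fixer ω e f ↔ g.1 e = e ∧ g.1 f = f := Iff.rfl

/-- The elements of the heart act on the plane as `±1`. -/
theorem heart_planeInv_apply (h : IsSymplecticForm ω) (h2 : (2 : F) ≠ 0) {e f : V}
    (hef : ω e f = 1) {g : isometryGroup ω} (hg : g ∈ heart (h.planeInv hef)) :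
    (g.1 e = e ∧ g.1 f = f) ∨ (g.1 e = -e ∧ g.1 f = -f) := by
  induction hg using Subgroup.closure_induction with
  | mem x hx =>
    obtain ⟨k, rfl⟩ := hx
    exact h.apply_eq_or_of_commute_planeInv h2 hef (zetaZero_mul_self _ _)
      (mul_zetaZero_comm (h.planeInv_mul_self hef) k)
  | one => exact Or.inl ⟨rfl, rfl⟩
  | mul x y _ _ hx hy =>
    rcases hx with ⟨h1, h3⟩ | ⟨h1, h3⟩ <;> rcases hy with ⟨h4, h5⟩ | ⟨h4, h5⟩ <;>
      simp only [mul_apply, h4, h5, map_neg, h1, h3, neg_neg, and_self, true_or, or_true]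
  | inv x _ hx =>
    rcases hx with ⟨h1, h3⟩ | ⟨h1, h3⟩
    · exact Or.inl ((fixer ω e f).inv_mem (x := x) ⟨h1, h3⟩)
    · right
      have h4 := congrArg x⁻¹.1 h1
      have h5 := congrArg x⁻¹.1 h3
      rw [inv_apply_apply, map_neg] at h4 h5
      exact ⟨neg_eq_iff_eq_neg.1 h4.symm, neg_eq_iff_eq_neg.1 h5.symm⟩

/-- Two elements of the heart carry `u` to `λ u`: the first one exchanges the plane of `u` with
an auxiliary plane, the second one exchanges them back with a twist by `λ`. -/
theorem exists_mem_heart_smul (h : IsSymplecticForm ω) (h2 : (2 : F) ≠ 0)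
    (hV : 5 ≤ finrank F V) {e f : V} (hef : ω e f = 1) {u : V} (hu : u ≠ 0)
    (he : ω u e = 0) (hf : ω u f = 0) {c : F} (hc : c ≠ 0) :
    ∃ k ∈ heart (h.planeInv hef), k.1 u = c • u := by
  obtain ⟨v, H⟩ := h.exists_frame hef hu he hf
  obtain ⟨x, hx0, hx⟩ := exists_ne_zero_orthogonal (ω := ω) ![e, f, u, v]
    (by simpa [Nat.lt_iff_add_one_le] using hV)
  obtain ⟨y, H1, H2⟩ := h.exists_frame_of_frame H hx0 (hx 0) (hx 1) (hx 2) (hx 3)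
  have H' := h.frame_symm H
  have H1' := h.frame_symm H1
  have H2' := h.frame_symm H2
  -- the involution of the plane `⟨u - d x, v - d⁻¹ y⟩` maps `u` to `d x` and `x` to `d⁻¹ u`
  have key : ∀ d : F, d ≠ 0 → ∃ k ∈ heart (h.planeInv hef),
      k.1 u = d • x ∧ k.1 x = d⁻¹ • u := by
    intro d hd
    have K : IsHyperbolicFrame ω e f (u - d • x) ((2 : F)⁻¹ • (v - d⁻¹ • y)) := by
      refine ⟨hef, ?_, ?_, ?_, ?_, ?_⟩
      · simp only [map_sub, map_smul, LinearMap.sub_apply, LinearMap.smul_apply, smul_eq_mul,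
          H.ef', H2.e_f', H2'.e_f', H2.ef']
        field_simp
        ring
      · simp [H.e_e', H1.e_e']
      · simp [H.e_f', H1.e_f']
      · simp [H.f_e', H1.f_e']
      · simp [H.f_f', H1.f_f']
    refine ⟨_, h.planeInv_mul_planeInv_mem_heart h2 K, ?_, ?_⟩
    · have : (h.planeInv K.ef').1 u = d • x := by
        rw [planeInv_apply, planeProj_apply]
        simp only [map_sub, map_smul, smul_eq_mul, H.ef', H2.e_f', H2.e_e', h.self]
        match_scalars <;> field_simp <;> ring
      rw [mul_apply, this, map_smul, h.planeInv_of_orthogonal K.ef H1'.e_e' H1'.e_f']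
    · have : (h.planeInv K.ef').1 x = d⁻¹ • u := by
        rw [planeInv_apply, planeProj_apply]
        simp only [map_sub, map_smul, smul_eq_mul, H2.ef', H2'.e_f', H2'.e_e', h.self]
        match_scalars <;> field_simp <;> ring
      rw [mul_apply, this, map_smul, h.planeInv_of_orthogonal K.ef H'.e_e' H'.e_f']
  obtain ⟨k, hk, hku, -⟩ := key 1 one_ne_zero
  obtain ⟨k', hk', -, hkx⟩ := key c⁻¹ (inv_ne_zero hc)
  refine ⟨k' * k, Subgroup.mul_mem _ hk' hk, ?_⟩
  rw [mul_apply, hku, one_smul, hkx, inv_inv]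

/-- The derived subgroup of the heart of a plane involution is the pointwise stabilizer of the
plane. -/
theorem commutator_heart_planeInv (h : IsSymplecticForm ω) (h2 : (2 : F) ≠ 0)
    (hV : 5 ≤ finrank F V) {c : F} (hc0 : c ≠ 0) (hc : c ^ 2 ≠ 1) {e f : V}
    (hef : ω e f = 1) :
    ⁅heart (h.planeInv hef), heart (h.planeInv hef)⁆ = fixer ω e f := by
  apply le_antisymm
  · rw [Subgroup.commutator_le]
    intro a ha b hb
    -- both elements act on the plane as scalars, hence their commutator acts trivially
    have hab : ∀ {x y : isometryGroup ω}, x ∈ heart (h.planeInv hef) →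
        y ∈ heart (h.planeInv hef) → x.1 (y.1 e) = y.1 (x.1 e) ∧ x.1 (y.1 f) = y.1 (x.1 f) := by
      intro x y hx hy
      rcases h.heart_planeInv_apply h2 hef hx with ⟨h1, h3⟩ | ⟨h1, h3⟩ <;>
        rcases h.heart_planeInv_apply h2 hef hy with ⟨h4, h5⟩ | ⟨h4, h5⟩ <;>
        simp only [h1, h3, h4, h5, map_neg, and_self]
    have h1 := hab (Subgroup.inv_mem _ ha) (Subgroup.inv_mem _ hb)
    rw [commutatorElement_def, mem_fixer]
    simp only [mul_apply, h1.1, h1.2, apply_inv_apply, and_self]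
  · intro g hg
    refine h.mem_of_transvection_mem {e, f} _ ?_ g (by simpa [mem_fixer] using hg)
    intro u hu a
    by_cases hu0 : u = 0
    · have : h.transvection u a = 1 := isometryGroup.ext fun x => by
        simp [transvection_apply, hu0]
      exact this ▸ Subgroup.one_mem _
    have hue := hu e (by simp)
    have huf := hu f (by simp)
    obtain ⟨k, hk, hku⟩ := h.exists_mem_heart_smul h2 hV hef hu0 hue huf hc0
    have hmem : ∀ b, h.transvection u b ∈ heart (h.planeInv hef) :=
      h.transvection_mem_of_normalizing hk hku hc fun b x hx =>
        conj_mem_heart (h.transvection_commute_planeInv hef hue huf b) hx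
    have hb : (c ^ 2 - 1) * ((c ^ 2 - 1)⁻¹ * a) = a :=
      mul_inv_cancel_left₀ (sub_ne_zero.2 hc) a
    rw [← hb, ← h.commutator_transvection hku, ← commutatorElement_def]
    exact Subgroup.commutator_mem_commutator hk (hmem _)

/-- In dimension four the involutions of the two planes of a frame differ by the scalar `-1`. -/
theorem planeInv_mul_planeInv_eq_negOne (h : IsSymplecticForm ω) (hV : finrank F V = 4)
    {e f e' f' : V} (H : IsHyperbolicFrame ω e f e' f') :
    h.planeInv H.ef * h.planeInv H.ef' = negOne ω := isometryGroup.ext fun v => by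
  have H' := h.frame_symm H
  have hv := h.eq_proj_add_proj H hV v
  rw [planeProj_apply, planeProj_apply] at hv
  rw [mul_apply, negOne_apply, hv]
  simp only [map_add, map_sub, map_smul, planeInv_fst, planeInv_snd, map_neg,
    h.planeInv_of_orthogonal H.ef H'.e_e' H'.e_f', h.planeInv_of_orthogonal H.ef H'.f_e' H'.f_f',
    h.planeInv_of_orthogonal H.ef' H.e_e' H.e_f', h.planeInv_of_orthogonal H.ef' H.f_e' H.f_f']
  module

theorem planeInv_eq_negOne_mul (h : IsSymplecticForm ω) (hV : finrank F V = 4)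
    {e f e' f' : V} (H : IsHyperbolicFrame ω e f e' f') :
    h.planeInv H.ef' = negOne ω * h.planeInv H.ef := by
  rw [negOne_comm, ← h.planeInv_mul_planeInv_eq_negOne hV H, ← mul_assoc, planeInv_mul_self,
    one_mul]

/-- In dimension four the heart of a plane involution is the center. -/
theorem heart_planeInv_eq_center (h : IsSymplecticForm ω) (h2 : (2 : F) ≠ 0)
    (hV : finrank F V = 4) {e f : V} (hef : ω e f = 1) :
    heart (h.planeInv hef) = Subgroup.center (isometryGroup ω) := by
  obtain ⟨x, hx0, hx⟩ := exists_ne_zero_orthogonal (ω := ω) ![e, f] (by simp [hV])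
  obtain ⟨y, H⟩ := h.exists_frame hef hx0 (hx 0) (hx 1)
  have H' := h.frame_symm H
  have hneg := h.planeInv_mul_planeInv_eq_negOne hV H
  have hneg' := h.planeInv_eq_negOne_mul hV H
  have hext : ∀ {g k : isometryGroup ω}, g.1 e = k.1 e → g.1 f = k.1 f → g.1 x = k.1 x →
      g.1 y = k.1 y → g = k := by
    intro g k h1 h3 h4 h5
    refine isometryGroup.ext fun v => ?_
    rw [h.eq_proj_add_proj H hV v, planeProj_apply, planeProj_apply]
    simp only [map_add, map_sub, map_smul, h1, h3, h4, h5]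
  have hnc : h.planeInv hef ∉ Subgroup.center (isometryGroup ω) := by
    rw [h.mem_center_iff h2]
    have hself : ∀ {a b : V}, ω a b = 1 → a ≠ -a := by
      intro a b hab haa
      have h5 := congrArg (fun v => ω v b) haa
      simp only [map_neg, LinearMap.neg_apply, hab] at h5
      exact h2 (by linear_combination h5)
    rintro (h1 | h1)
    · have h3 := h.planeInv_fst hef
      rw [h1, one_apply] at h3
      exact hself hef h3
    · have h3 := h.planeInv_of_orthogonal hef H'.e_e' H'.e_f'
      rw [h1, negOne_apply] at h3
      exact hself H.ef' h3.symm
  apply le_antisymm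
  · rw [heart, Subgroup.closure_le]
    rintro _ ⟨g, rfl⟩
    have hzz := zetaZero_mul_self (h.planeInv hef) g
    have hzc := mul_zetaZero_comm (h.planeInv_mul_self hef) g
    set z := zetaZero (h.planeInv hef) g with hz
    have hzc' : h.planeInv H.ef' * z = z * h.planeInv H.ef' := by
      rw [hneg', mul_assoc, hzc, ← mul_assoc, negOne_comm, mul_assoc]
    have hnot : z * h.planeInv hef ∉ Subgroup.center (isometryGroup ω) := fun hmem =>
      hnc (mem_center_of_zetaZero_mul_mem (h.planeInv_mul_self hef) hmem)
    rw [SetLike.mem_coe]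
    rw [h.mem_center_iff h2] at hnot ⊢
    rcases h.apply_eq_or_of_commute_planeInv h2 hef hzz hzc with ⟨h1, h3⟩ | ⟨h1, h3⟩ <;>
      rcases h.apply_eq_or_of_commute_planeInv h2 H.ef' hzz hzc' with ⟨h4, h5⟩ | ⟨h4, h5⟩
    · exact Or.inl (hext h1 h3 h4 h5)
    · refine absurd (Or.inr (hext ?_ ?_ ?_ ?_)) hnot
      · rw [mul_apply, planeInv_fst, map_neg, h1, negOne_apply]
      · rw [mul_apply, planeInv_snd, map_neg, h3, negOne_apply]
      · rw [mul_apply, h.planeInv_of_orthogonal hef H'.e_e' H'.e_f', h4, negOne_apply]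
      · rw [mul_apply, h.planeInv_of_orthogonal hef H'.f_e' H'.f_f', h5, negOne_apply]
    · refine absurd (Or.inl (hext ?_ ?_ ?_ ?_)) hnot
      · rw [mul_apply, planeInv_fst, map_neg, h1, neg_neg, one_apply]
      · rw [mul_apply, planeInv_snd, map_neg, h3, neg_neg, one_apply]
      · rw [mul_apply, h.planeInv_of_orthogonal hef H'.e_e' H'.e_f', h4, one_apply]
      · rw [mul_apply, h.planeInv_of_orthogonal hef H'.f_e' H'.f_f', h5, one_apply]
    · exact Or.inr (hext h1 h3 h4 h5)
  · intro g hg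
    rcases (h.mem_center_iff h2 g).1 hg with rfl | rfl
    · exact Subgroup.one_mem _
    · rw [← hneg]
      exact h.planeInv_mul_planeInv_mem_heart h2 H

end IsSymplecticForm

/-! ### Hearts modulo scalars -/

namespace IsSymplecticForm

open isometryGroup

section Quotients

variable {F V : Type*} [Field F] [AddCommGroup V] [Module F V] {ω : LinearMap.BilinForm F V}
  [FiniteDimensional F V] {G : Type*} [Group G]

/-- In dimension at least five a product of two conjugate plane involutions fixes a nonzero
vector, so that no power of it is `-1`; the heart is then compatible with passing to the quotient
by scalars. -/
theorem map_heart_planeInv (h : IsSymplecticForm ω) (h2 : (2 : F) ≠ 0)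
    (hV : 5 ≤ finrank F V) {e f : V} (hef : ω e f = 1) (π : isometryGroup ω →* G)
    (hπ : Function.Surjective π) (hker : ∀ g, π g = 1 → g = 1 ∨ g = negOne ω) :
    (heart (h.planeInv hef)).map π = heart (π (h.planeInv hef)) := by
  refine map_heart π hπ _ fun g => ?_
  obtain ⟨v, hv0, hv⟩ := exists_ne_zero_orthogonal (ω := ω) ![e, f, g⁻¹.1 e, g⁻¹.1 f]
    (by simpa [Nat.lt_iff_add_one_le] using hV)
  set t := h.planeInv hef with ht
  have hgv : ∀ y, ω v (g⁻¹.1 y) = 0 → ω (g.1 v) y = 0 := by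
    intro y hy
    rwa [← isom g, apply_inv_apply] at hy
  have hfix : (t * (g⁻¹ * t * g)).1 v = v := by
    rw [mul_apply, mul_apply, mul_apply, ht,
      h.planeInv_of_orthogonal hef (hgv _ (hv 2)) (hgv _ (hv 3)), inv_apply_apply,
      h.planeInv_of_orthogonal hef (hv 0) (hv 1)]
  set x := t * (g⁻¹ * t * g) with hx
  have hpow : ∀ n : ℕ, (x ^ n).1 v = v := by
    intro n
    induction n with
    | zero => rfl
    | succ n ih => rw [pow_succ, mul_apply, hfix, ih]
  rw [orderOf_eq_orderOf_iff]
  intro n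
  rw [← map_pow]
  refine ⟨fun hn => ?_, fun hn => by rw [hn, map_one]⟩
  refine (hker _ hn).resolve_right fun h3 => hv0 ?_
  have h4 := hpow n
  rw [h3, negOne_apply, neg_eq_iff_add_eq_zero, ← two_smul F] at h4
  exact (smul_eq_zero_iff_right h2).1 h4

theorem nonempty_commutator_heart_equiv_fixer (h : IsSymplecticForm ω) (h2 : (2 : F) ≠ 0)
    (hV : 5 ≤ finrank F V) {c : F} (hc0 : c ≠ 0) (hc : c ^ 2 ≠ 1) {e f : V} (hef : ω e f = 1)
    (π : isometryGroup ω →* G) (hπ : Function.Surjective π)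
    (hker : ∀ g, π g = 1 → g = 1 ∨ g = negOne ω) :
    Nonempty ((⁅heart (π (h.planeInv hef)), heart (π (h.planeInv hef))⁆ : Subgroup G) ≃*
      fixer ω e f) := by
  rw [← h.map_heart_planeInv h2 hV hef π hπ hker, ← Subgroup.map_commutator,
    h.commutator_heart_planeInv h2 hV hc0 hc hef]
  have hinj : Function.Injective (π.comp (fixer ω e f).subtype) := by
    rw [injective_iff_map_eq_one]
    intro g hg
    refine Subtype.ext ((hker _ hg).resolve_right fun h3 => ?_)
    have h4 := (mem_fixer.1 g.2).1
    have h5 : g.1.1 e = -e := by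
      have : g.1 = negOne ω := h3
      rw [this, negOne_apply]
    have h6 := congrArg (fun v => ω v f) (h4.symm.trans h5)
    simp only [map_neg, LinearMap.neg_apply, hef] at h6
    exact h2 (by linear_combination h6)
  have hrange : (π.comp (fixer ω e f).subtype).range = (fixer ω e f).map π := by
    rw [MonoidHom.range_comp, Subgroup.range_subtype]
  exact ⟨((MonoidHom.ofInjective hinj).trans (MulEquiv.subgroupCongr hrange)).symm⟩

/-- In dimension four the square of a quarter turn is `-1`, so the quarter turn itself is
produced from the plane involution modulo scalars. -/
theorem map_quarterTurn_mem_heart (h : IsSymplecticForm ω) (h2 : (2 : F) ≠ 0)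
    (hV : finrank F V = 4) {e f e' f' : V} (H : IsHyperbolicFrame ω e f e' f')
    (π : isometryGroup ω →* G) (hker : ∀ g, π g = 1 ↔ g = 1 ∨ g = negOne ω) :
    π (h.quarterTurn H) ∈ heart (π (h.planeInv H.ef)) := by
  obtain ⟨g, hg⟩ := h.quarterTurn_eq H h2
  have ho : orderOf (π (h.quarterTurn H)) = 2 := by
    refine orderOf_eq_prime ?_ ?_
    · rw [sq, ← map_mul, h.quarterTurn_sq H, h.planeInv_mul_planeInv_eq_negOne hV H]
      exact (hker _).2 (Or.inr rfl)
    · intro h1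
      have h3 := h.quarterTurn_e H
      have h4 : ω ((h.quarterTurn H).1 e) f' = 1 := by rw [h3, H.ef']
      rcases (hker _).1 h1 with h5 | h5
      · rw [h5, one_apply, H.e_f'] at h4
        exact zero_ne_one h4
      · rw [h5, negOne_apply, map_neg, LinearMap.neg_apply, H.e_f', neg_zero] at h4
        exact zero_ne_one h4
  have hx : π (h.planeInv H.ef) * ((π g)⁻¹ * π (h.planeInv H.ef) * π g) =
      π (h.quarterTurn H) := by
    rw [← hg]
    simp
  have hz : zetaZero (π (h.planeInv H.ef)) (π g) = π (h.quarterTurn H) := by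
    rw [zetaZero, hx, if_pos (by rw [ho]; decide), producedInvolution, ho, Nat.div_self two_pos,
      pow_one]
  exact hz ▸ zetaZero_mem_heart _ _

theorem map_transvection_mem_heart (h : IsSymplecticForm ω) (h2 : (2 : F) ≠ 0)
    (hV : finrank F V = 4) {c : F} (hc0 : c ≠ 0) (hc : c ^ 2 ≠ 1)
    {e f u : V} (hef : ω e f = 1) (he : ω u e = 0) (hf : ω u f = 0)
    (π : isometryGroup ω →* G) (hker : ∀ g, π g = 1 ↔ g = 1 ∨ g = negOne ω) (a : F) :
    π (h.transvection u a) ∈ heart (π (h.planeInv hef)) := by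
  by_cases hu0 : u = 0
  · have : h.transvection u a = 1 := isometryGroup.ext fun x => by
      simp [transvection_apply, hu0]
    rw [this, map_one]
    exact Subgroup.one_mem _
  obtain ⟨v, H⟩ := h.exists_frame hef hu0 he hf
  -- the quarter turns of `(e, f), (u, v)` and of `(e, f), (c⁻¹ u, c v)` multiply to an isometry
  -- that scales `u` by `-c⁻¹`
  have K : IsHyperbolicFrame ω e f (c⁻¹ • u) (c • v) :=
    ⟨hef, by simp [H.ef', hc0], by simp [H.e_e'], by simp [H.e_f'], by simp [H.f_e'],
      by simp [H.f_f']⟩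
  have hk : h.quarterTurn K * h.quarterTurn H ∈ (heart (π (h.planeInv hef))).comap π := by
    rw [Subgroup.mem_comap, map_mul]
    exact Subgroup.mul_mem _ (h.map_quarterTurn_mem_heart h2 hV K π hker)
      (h.map_quarterTurn_mem_heart h2 hV H π hker)
  have hku : (h.quarterTurn K * h.quarterTurn H).1 u = (-c⁻¹) • u := by
    rw [mul_apply, quarterTurn_e', map_neg, quarterTurn_e, neg_smul]
  have hμ : (-c⁻¹) ^ 2 ≠ 1 := by
    rwa [neg_sq, inv_pow, Ne, inv_eq_one]
  refine h.transvection_mem_of_normalizing hk hku hμ (fun b x hx => ?_) a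
  rw [Subgroup.mem_comap, map_mul, map_mul, map_inv]
  refine conj_mem_heart ?_ hx
  rw [← map_mul, h.transvection_commute_planeInv hef he hf, map_mul]

omit [FiniteDimensional F V] in
theorem form_planeProj_sub (h : IsSymplecticForm ω) {e f : V} (hef : ω e f = 1) (x y : V) :
    ω (planeProj ω e f x) (y - planeProj ω e f y) = 0 := by
  have hfe : ω f e = -1 := by rw [h.swap, hef]
  simp only [planeProj_apply, map_sub, map_smul, LinearMap.sub_apply, LinearMap.smul_apply,
    smul_eq_mul, h.self, hef, hfe, h.swap e y, h.swap f y]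
  ring

/-- An isometry that commutes with the involution of a plane preserves this plane, and its
restriction to the plane extends by the identity on the orthogonal complement. -/
theorem exists_fixing_complement (h : IsSymplecticForm ω) (h2 : (2 : F) ≠ 0) {e f : V}
    (hef : ω e f = 1) {g : isometryGroup ω} (hg : g * h.planeInv hef = h.planeInv hef * g) :
    ∃ k : isometryGroup ω, k.1 e = g.1 e ∧ k.1 f = g.1 f ∧
      ∀ x, ω x e = 0 → ω x f = 0 → k.1 x = x := by
  have hP : ∀ x, g.1 (planeProj ω e f x) = planeProj ω e f (g.1 x) := by
    intro x
    have h1 := congrArg (fun k : isometryGroup ω => k.1 x) hg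
    simp only [mul_apply, planeInv_apply, map_sub, map_smul, sub_right_inj] at h1
    exact smul_right_injective V h2 h1
  have horth := h.form_planeProj_sub hef
  have horth' : ∀ x y, ω (y - planeProj ω e f y) (planeProj ω e f x) = 0 := by
    intro x y
    rw [h.swap, horth, neg_zero]
  have hdec : ∀ x y, ω x y = ω (x - planeProj ω e f x) (y - planeProj ω e f y) +
      ω (planeProj ω e f x) (planeProj ω e f y) := by
    intro x y
    have h1 := horth x y
    have h3 := horth' y x
    simp only [map_sub, LinearMap.sub_apply] at h1 h3 ⊢
    linear_combination h1 + h3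
  refine ⟨h.mkIsom (LinearMap.id - planeProj ω e f + g.1.toLinearMap ∘ₗ planeProj ω e f) ?_,
    ?_, ?_, ?_⟩
  · intro x y
    have h1 : ∀ x y, ω (g.1 (planeProj ω e f x)) (y - planeProj ω e f y) = 0 := by
      intro x y
      rw [hP, horth]
    have h3 : ω (x - planeProj ω e f x) (g.1 (planeProj ω e f y)) = 0 := by
      rw [h.swap, h1, neg_zero]
    simp only [LinearMap.add_apply, LinearMap.sub_apply, LinearMap.id_apply,
      LinearMap.comp_apply, LinearEquiv.coe_coe]
    rw [map_add, map_add ω, LinearMap.add_apply, LinearMap.add_apply, h1 x y, h3, isom, hdec x y,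
      zero_add, add_zero]
  · have : planeProj ω e f e = e := by simp [planeProj_apply, hef, h.self]
    simp [this]
  · have : planeProj ω e f f = f := by simp [planeProj_apply, h.self, h.swap f e, hef]
    simp [this]
  · intro x he hf
    have : planeProj ω e f x = 0 := by simp [planeProj_apply, he, hf]
    simp [this]

/-- In dimension four, modulo scalars, the heart of a plane involution contains its
centralizer in the symplectic group. -/
theorem map_mem_heart_of_commute (h : IsSymplecticForm ω) (h2 : (2 : F) ≠ 0)
    (hV : finrank F V = 4) {c : F} (hc0 : c ≠ 0) (hc : c ^ 2 ≠ 1)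
    {e f : V} (hef : ω e f = 1) (π : isometryGroup ω →* G)
    (hker : ∀ g, π g = 1 ↔ g = 1 ∨ g = negOne ω) {g : isometryGroup ω}
    (hg : g * h.planeInv hef = h.planeInv hef * g) : π g ∈ heart (π (h.planeInv hef)) := by
  obtain ⟨x, hx0, hx⟩ := exists_ne_zero_orthogonal (ω := ω) ![e, f] (by simp [hV])
  obtain ⟨y, H⟩ := h.exists_frame hef hx0 (hx 0) (hx 1)
  have H' := h.frame_symm H
  obtain ⟨k, hke, hkf, hk⟩ := h.exists_fixing_complement h2 hef hg
  have hheart : heart (π (h.planeInv H.ef')) = heart (π (h.planeInv hef)) := by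
    rw [h.planeInv_eq_negOne_mul hV H, map_mul, (hker _).2 (Or.inr rfl), one_mul]
  have hkmem : k ∈ (heart (π (h.planeInv hef))).comap π := by
    refine h.mem_of_transvection_mem {x, y} _ (fun u hu a => ?_) k ?_
    · rw [Subgroup.mem_comap, ← hheart]
      exact h.map_transvection_mem_heart h2 hV hc0 hc H.ef' (hu x (by simp)) (hu y (by simp))
        π hker a
    · simp only [Set.mem_insert_iff, Set.mem_singleton_iff, forall_eq_or_imp, forall_eq]
      exact ⟨hk x H'.e_e' H'.e_f', hk y H'.f_e' H'.f_f'⟩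
  have hkgmem : k⁻¹ * g ∈ (heart (π (h.planeInv hef))).comap π := by
    refine h.mem_of_transvection_mem {e, f} _ (fun u hu a => ?_) _ ?_
    · exact h.map_transvection_mem_heart h2 hV hc0 hc hef (hu e (by simp)) (hu f (by simp))
        π hker a
    · simp only [Set.mem_insert_iff, Set.mem_singleton_iff, forall_eq_or_imp, forall_eq,
        mul_apply]
      rw [← hke, ← hkf]
      exact ⟨inv_apply_apply k e, inv_apply_apply k f⟩
  have := Subgroup.mul_mem _ hkmem hkgmem
  rwa [mul_inv_cancel_left] at this

/-- Perfect subgroups of the centralizer of `π t` lie in its derived subgroup; this consists of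
images of elements commuting with `t`, because a lift of an element of the centralizer maps `t`
to `± t`. -/
theorem semisimpleSocle_le_heart (h : IsSymplecticForm ω) (h2 : (2 : F) ≠ 0)
    (hV : finrank F V = 4) {c : F} (hc0 : c ≠ 0) (hc : c ^ 2 ≠ 1)
    {e f : V} (hef : ω e f = 1) (π : isometryGroup ω →* G) (hπ : Function.Surjective π)
    (hker : ∀ g, π g = 1 ↔ g = 1 ∨ g = negOne ω) :
    (semisimpleSocle (Subgroup.centralizer {π (h.planeInv hef)})).map
      (Subgroup.centralizer {π (h.planeInv hef)}).subtype ≤ heart (π (h.planeInv hef)) := by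
  rw [Subgroup.map_le_iff_le_comap, semisimpleSocle]
  refine sSup_le ?_
  rintro L ⟨-, hperf, -⟩
  rw [← Subgroup.isPerfect_iff.1 hperf, Subgroup.commutator_le]
  rintro ⟨a, ha⟩ - ⟨b, hb⟩ -
  obtain ⟨A, rfl⟩ := hπ a
  obtain ⟨B, rfl⟩ := hπ b
  set t := h.planeInv hef with ht
  have hsemi : ∀ C, π C ∈ Subgroup.centralizer {π t} →
      SemiconjBy C t t ∨ SemiconjBy C t (negOne ω * t) := by
    intro C hC
    have h1 := Subgroup.mem_centralizer_singleton_iff.1 hC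
    have h3 : π (C * t * C⁻¹ * t⁻¹) = 1 := by
      simp only [map_mul, map_inv]
      rw [h1]
      group
    rcases (hker _).1 h3 with h4 | h4
    · left
      rw [mul_inv_eq_one, mul_inv_eq_iff_eq_mul] at h4
      exact h4
    · right
      rw [mul_inv_eq_iff_eq_mul, mul_inv_eq_iff_eq_mul] at h4
      exact h4
  have hneg : ∀ (C x y : isometryGroup ω), SemiconjBy C x y →
      SemiconjBy C (negOne ω * x) (negOne ω * y) := fun C x y hC =>
    SemiconjBy.mul_right (negOne_comm C).symm hC
  have hnn : ∀ x : isometryGroup ω, negOne ω * (negOne ω * x) = x := fun x => by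
    rw [← mul_assoc, negOne_mul_self, one_mul]
  have hcomm : SemiconjBy (A * B * A⁻¹ * B⁻¹) t t := by
    have hall : ∀ C, π C ∈ Subgroup.centralizer {π t} →
        (SemiconjBy C t t ∧ SemiconjBy C (negOne ω * t) (negOne ω * t)) ∨
        (SemiconjBy C t (negOne ω * t) ∧ SemiconjBy C (negOne ω * t) t) := by
      intro C hC
      rcases hsemi C hC with h1 | h1
      · exact Or.inl ⟨h1, hneg _ _ _ h1⟩
      · refine Or.inr ⟨h1, ?_⟩
        have h3 := hneg _ _ _ h1
        rwa [hnn] at h3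
    rcases hall A ha with ⟨a1, a2⟩ | ⟨a1, a2⟩ <;> rcases hall B hb with ⟨b1, b2⟩ | ⟨b1, b2⟩
    · exact ((a1.mul_left b1).mul_left a1.inv_symm_left).mul_left b1.inv_symm_left
    · exact ((a1.mul_left b2).mul_left a2.inv_symm_left).mul_left b2.inv_symm_left
    · exact ((a2.mul_left b2).mul_left a2.inv_symm_left).mul_left b1.inv_symm_left
    · exact ((a2.mul_left b1).mul_left a1.inv_symm_left).mul_left b2.inv_symm_left
  have hmem := h.map_mem_heart_of_commute h2 hV hc0 hc hef π hker hcomm.eq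
  rw [map_mul, map_mul, map_mul, map_inv, map_inv] at hmem
  exact hmem

end Quotients

end IsSymplecticForm

/-! ### Symplectic matrices -/

namespace IsSymplecticForm

open isometryGroup

section Matrices

variable {F V : Type*} [Field F] [AddCommGroup V] [Module F V] {ω : LinearMap.BilinForm F V}
  [FiniteDimensional F V]

/-- A symplectic space of dimension at least `2n` contains `n` mutually orthogonal hyperbolic
pairs. -/
theorem exists_hyperbolic_family (h : IsSymplecticForm ω) (n : ℕ) (hn : 2 * n ≤ finrank F V) :
    ∃ a b : Fin n → V, (∀ i j, ω (a i) (a j) = 0) ∧ (∀ i j, ω (b i) (b j) = 0) ∧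
      ∀ i j, ω (a i) (b j) = if i = j then 1 else 0 := by
  induction n with
  | zero => exact ⟨0, 0, by simp, by simp, fun i => i.elim0⟩
  | succ n ih =>
    obtain ⟨a, b, haa, hbb, hab⟩ := ih (by omega)
    obtain ⟨x, hx0, hx⟩ := exists_ne_zero_orthogonal (ω := ω) (Sum.elim a b)
      (by simp; omega)
    have hxa : ∀ i, ω x (a i) = 0 := fun i => hx (Sum.inl i)
    have hxb : ∀ i, ω x (b i) = 0 := fun i => hx (Sum.inr i)
    obtain ⟨z, hz⟩ := h.exists_eq_one hx0
    have hba : ∀ i j, ω (b i) (a j) = if j = i then -1 else 0 := by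
      intro i j
      rw [h.swap, hab]
      split_ifs <;> simp
    set y := z - ∑ k, planeProj ω (a k) (b k) z with hy
    have hxy : ω x y = 1 := by
      simp [hy, planeProj_apply, hz, hxa, hxb]
    have hay : ∀ i, ω (a i) y = 0 := by
      intro i
      simp [hy, planeProj_apply, haa, hab, h.swap (a i) z]
    have hby : ∀ i, ω (b i) y = 0 := by
      intro i
      simp [hy, planeProj_apply, hbb, hba, h.swap (b i) z]
    have hax : ∀ i, ω (a i) x = 0 := fun i => by rw [h.swap, hxa, neg_zero]
    have hbx : ∀ i, ω (b i) x = 0 := fun i => by rw [h.swap, hxb, neg_zero]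
    have hya : ∀ i, ω y (a i) = 0 := fun i => by rw [h.swap, hay, neg_zero]
    have hyb : ∀ i, ω y (b i) = 0 := fun i => by rw [h.swap, hby, neg_zero]
    refine ⟨Fin.cons x a, Fin.cons y b, ?_, ?_, ?_⟩
    · simp [Fin.forall_fin_succ, h.self, hxa, hax, haa]
    · simp [Fin.forall_fin_succ, h.self, hyb, hby, hbb]
    · simp [Fin.forall_fin_succ, hxy, hxb, hay, hab, Fin.succ_ne_zero, (Fin.succ_ne_zero _).symm]

/-- A symplectic space of dimension `2n` has a basis with Gram matrix `J`. -/
theorem exists_basis_toMatrix_eq_J (h : IsSymplecticForm ω) (n : ℕ) (hn : finrank F V = 2 * n) :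
    ∃ b : Basis (Fin n ⊕ Fin n) F V, LinearMap.BilinForm.toMatrix b ω = Matrix.J (Fin n) F := by
  obtain ⟨a, b, haa, hbb, hab⟩ := h.exists_hyperbolic_family n hn.ge
  have hba : ∀ i j, ω (b i) (a j) = -(if j = i then 1 else 0) := fun i j => by
    rw [h.swap, hab]
  have hli : LinearIndependent F (Sum.elim b a) := by
    rw [Fintype.linearIndependent_iff]
    intro c hc
    rw [Fintype.sum_sum_type] at hc
    simp only [Sum.elim_inl, Sum.elim_inr] at hc
    rintro (i | i)
    · have h1 := congrArg (fun v => ω v (a i)) hc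
      simpa [hba, haa] using h1
    · have h1 := congrArg (fun v => ω v (b i)) hc
      simpa [hab, hbb] using h1
  refine ⟨basisOfLinearIndependentOfCardEqFinrank' _ hli (by simp [hn]; ring), ?_⟩
  ext i j
  rw [LinearMap.BilinForm.toMatrix_apply]
  simp only [coe_basisOfLinearIndependentOfCardEqFinrank']
  rcases i with i | i <;> rcases j with j | j <;>
    simp [Matrix.J, haa, hbb, hab, hba, Matrix.one_apply, eq_comm]

/-- In a basis with Gram matrix `J`, the isometry group becomes the group of symplectic
matrices. -/
theorem exists_mulEquiv_of_basis (h : IsSymplecticForm ω) {n : ℕ}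
    (b : Basis (Fin n ⊕ Fin n) F V) (hb : LinearMap.BilinForm.toMatrix b ω = Matrix.J (Fin n) F) :
    ∃ Ψ : isometryGroup ω ≃* Sp2n n F,
      ∀ g, (Ψ g : Matrix (Fin n ⊕ Fin n) (Fin n ⊕ Fin n) F) =
        LinearMap.toMatrix b b g.1.toLinearMap := by
  have hiff : ∀ g : V →ₗ[F] V, (∀ x y, ω (g x) (g y) = ω x y) ↔
      LinearMap.toMatrix b b g ∈ Matrix.symplecticGroup (Fin n) F := by
    intro g
    rw [SymplecticGroup.mem_iff', ← hb, ← LinearMap.BilinForm.toMatrix_comp b b,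
      (LinearMap.BilinForm.toMatrix b).injective.eq_iff]
    constructor
    · intro hg
      ext x y
      exact hg x y
    · intro hg x y
      exact congrArg (fun B : LinearMap.BilinForm F V => B x y) hg
  let φ : isometryGroup ω →* Sp2n n F :=
    { toFun := fun g => ⟨LinearMap.toMatrix b b g.1.toLinearMap, (hiff _).1 g.2⟩
      map_one' := Subtype.ext (LinearMap.toMatrix_id b)
      map_mul' := fun g k => Subtype.ext (LinearMap.toMatrix_mul b g.1.toLinearMap
        k.1.toLinearMap) }
  have hφ : Function.Bijective φ := by
    constructor
    · intro g k hgk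
      have h1 := (LinearMap.toMatrix b b).injective (congrArg Subtype.val hgk)
      exact isometryGroup.ext fun x => congrArg (fun l : V →ₗ[F] V => l x) h1
    · intro A
      have hA : LinearMap.toMatrix b b (Matrix.toLin b b A.1) = A.1 :=
        LinearMap.toMatrix_toLin b b A.1
      refine ⟨h.mkIsom (Matrix.toLin b b A.1) ((hiff _).2 (hA.symm ▸ A.2)), Subtype.ext ?_⟩
      exact hA
  exact ⟨MulEquiv.ofBijective φ hφ, fun g => rfl⟩

/-- The pointwise stabilizer of the plane of a hyperbolic pair is the symplectic group of the
orthogonal complement. -/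
theorem nonempty_fixer_equiv (h : IsSymplecticForm ω) {n : ℕ} (hn : finrank F V = 2 * n)
    {e f : V} (hef : ω e f = 1) : Nonempty (fixer ω e f ≃* Sp2n (n - 1) F) := by
  have hfe : ω f e = -1 := by rw [h.swap, hef]
  have hPe : planeProj ω e f e = e := by simp [planeProj_apply, hef, h.self]
  have hPf : planeProj ω e f f = f := by simp [planeProj_apply, hfe, h.self]
  set L : V →ₗ[F] F × F := (ω.flip e).prod (ω.flip f) with hL
  set U := LinearMap.ker L with hU
  have hmem : ∀ {x : V}, x ∈ U ↔ ω x e = 0 ∧ ω x f = 0 := by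
    intro x
    rw [hU, LinearMap.mem_ker, hL]
    exact Prod.mk_eq_zero
  have hfin : finrank F U = 2 * (n - 1) := by
    have hsurj : LinearMap.range L = ⊤ := by
      rw [LinearMap.range_eq_top]
      rintro ⟨a, b⟩
      exact ⟨b • e - a • f, by simp [hL, hef, hfe, h.self]⟩
    have h1 : _ + finrank F U = _ := LinearMap.finrank_range_add_finrank_ker L
    rw [hsurj, finrank_top, Module.finrank_prod, Module.finrank_self] at h1
    omega
  have hq : ∀ x, x - planeProj ω e f x ∈ U := by
    intro x
    rw [hmem]
    simp [planeProj_apply, hef, hfe, h.self]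
  let q : V →ₗ[F] U := (LinearMap.id - planeProj ω e f).codRestrict U hq
  have hqx : ∀ x, ((q x : U) : V) = x - planeProj ω e f x := fun x => rfl
  have hPU : ∀ x ∈ U, planeProj ω e f x = 0 := by
    intro x hx
    rw [planeProj_apply, (hmem.1 hx).1, (hmem.1 hx).2]
    simp
  have hqU : ∀ x : U, q x = x := fun x => Subtype.ext (by rw [hqx, hPU x x.2, sub_zero])
  -- the restriction of the form to `U` is symplectic
  let ωU : LinearMap.BilinForm F U := ω.restrict U
  have hω : ∀ x y : U, ωU x y = ω x y := fun x y => rfl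
  have hPorth : ∀ x, ∀ y ∈ U, ω (planeProj ω e f x) y = 0 := by
    intro x y hy
    have := h.form_planeProj_sub hef x y
    rwa [hPU y hy, sub_zero] at this
  have hsymp : IsSymplecticForm ωU := by
    refine ⟨fun x => h.self x, fun x hx => Subtype.ext (h.eq_zero x fun y => ?_)⟩
    have h1 := hx (q y)
    rw [hω, hqx, map_sub, h.swap _ (planeProj ω e f y), hPorth y x x.2] at h1
    simpa using h1
  have hdec : ∀ x y, ω x y = ω (q x) (q y) + ω (planeProj ω e f x) (planeProj ω e f y) := by
    intro x y
    have h1 := h.form_planeProj_sub hef x y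
    have h3 := h.form_planeProj_sub hef y x
    rw [h.swap] at h3
    simp only [hqx, map_sub, LinearMap.sub_apply] at h1 h3 ⊢
    linear_combination h1 - h3
  let φ : isometryGroup ωU →* isometryGroup ω :=
    { toFun := fun g => h.mkIsom (planeProj ω e f + U.subtype ∘ₗ g.1.toLinearMap ∘ₗ q)
        fun x y => by
          have h1 : ∀ x y, ω (g.1 (q x) : U) (planeProj ω e f y) = 0 := by
            intro x y
            rw [h.swap, hPorth y _ (g.1 (q x)).2, neg_zero]
          have h3 : ω (g.1 (q x) : U) (g.1 (q y) : U) = ω (q x) (q y) := isom g (q x) (q y)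
          simp only [LinearMap.add_apply, LinearMap.comp_apply, LinearEquiv.coe_coe,
            Submodule.subtype_apply, map_add, h1, h3, hPorth x _ (g.1 (q y)).2, hdec x y]
          ring
      map_one' := isometryGroup.ext fun x => by
        rw [mkIsom_apply, one_apply]
        change planeProj ω e f x + ((q x : U) : V) = x
        rw [hqx, add_sub_cancel]
      map_mul' := fun g k => isometryGroup.ext fun x => by
        rw [mul_apply]
        change planeProj ω e f x + (g.1 (k.1 (q x)) : U) =
          planeProj ω e f (planeProj ω e f x + (k.1 (q x) : U)) +
            (g.1 (q (planeProj ω e f x + (k.1 (q x) : U))) : U)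
        have hPP : planeProj ω e f (planeProj ω e f x) = planeProj ω e f x := by
          rw [planeProj_apply e f x]
          simp only [map_sub, map_smul, hPe, hPf]
        have hqP : q (planeProj ω e f x) = 0 := Subtype.ext (by
          rw [hqx, hPP, sub_self]
          rfl)
        rw [map_add, hPP, hPU _ (k.1 (q x)).2, map_add, hqP, zero_add, hqU, add_zero] }
  have hφx : ∀ g x, (φ g).1 x = planeProj ω e f x + (g.1 (q x) : U) := fun g x => rfl
  have hinj : Function.Injective φ := by
    intro g k hgk
    refine isometryGroup.ext fun x => Subtype.ext ?_
    have h1 := congrArg (fun l : isometryGroup ω => l.1 x) hgk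
    simpa only [hφx, hqU, add_right_inj] using h1
  have hrange : φ.range = fixer ω e f := by
    ext g
    rw [mem_fixer]
    constructor
    · rintro ⟨k, rfl⟩
      have hqe : q e = 0 := Subtype.ext (by rw [hqx, hPe, sub_self]; rfl)
      have hqf : q f = 0 := Subtype.ext (by rw [hqx, hPf, sub_self]; rfl)
      rw [hφx, hφx, hqe, hqf, hPe, hPf]
      simp
    · rintro ⟨hge, hgf⟩
      have hgU : ∀ x ∈ U, g.1.toLinearMap x ∈ U := by
        intro x hx
        rw [hmem] at hx ⊢
        have h1 := isom g x e
        have h3 := isom g x f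
        rw [hge, hx.1] at h1
        rw [hgf, hx.2] at h3
        exact ⟨h1, h3⟩
      refine ⟨hsymp.mkIsom (g.1.toLinearMap.restrict hgU) fun x y => isom g x y,
        isometryGroup.ext fun x => ?_⟩
      change planeProj ω e f x + g.1 (q x) = g.1 x
      have hgP : g.1 (planeProj ω e f x) = planeProj ω e f x := by
        simp only [planeProj_apply, map_sub, map_smul, hge, hgf]
      rw [hqx, map_sub, hgP, add_sub_cancel]
  obtain ⟨b, hb⟩ := hsymp.exists_basis_toMatrix_eq_J (n - 1) hfin
  obtain ⟨Ψ, -⟩ := hsymp.exists_mulEquiv_of_basis b hb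
  exact ⟨((MonoidHom.ofInjective hinj).trans (MulEquiv.subgroupCongr hrange)).symm.trans Ψ⟩

/-- An isometry of order two whose `(-1)`-eigenspace is a plane is the involution of a
hyperbolic pair. -/
theorem exists_eq_planeInv (h : IsSymplecticForm ω) (h2 : (2 : F) ≠ 0) {g : isometryGroup ω}
    (hgg : g * g = 1) (hfin : finrank F (Module.End.eigenspace g.1.toLinearMap (-1)) = 2) :
    ∃ (e f : V) (hef : ω e f = 1), g = h.planeInv hef := by
  set W := Module.End.eigenspace g.1.toLinearMap (-1) with hW
  have hmem : ∀ {x}, x ∈ W ↔ g.1 x = -x := by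
    intro x
    rw [hW, Module.End.mem_eigenspace_iff]
    simp
  have hg2 : ∀ x, g.1 (g.1 x) = x := fun x => by rw [← mul_apply, hgg, one_apply]
  have hadj : ∀ x y, ω (g.1 x) y = ω x (g.1 y) := by
    intro x y
    rw [← isom g x, hg2]
  have hWbot : W ≠ ⊥ := by
    intro h0
    rw [h0, finrank_bot] at hfin
    exact absurd hfin (by norm_num)
  obtain ⟨e, he, he0⟩ := Submodule.exists_mem_ne_zero_of_ne_bot hWbot
  obtain ⟨y, hy⟩ := h.exists_eq_one he0
  have hge := hmem.1 he
  -- the partner of `e` is the component in `W` of a vector paired to `1` with `e`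
  set f := (2 : F)⁻¹ • (y - g.1 y) with hf
  have hfW : f ∈ W := by
    rw [hmem, hf, map_smul, map_sub, hg2]
    module
  have hef : ω e f = 1 := by
    have h1 : ω e (g.1 y) = -1 := by
      rw [← hadj, hge, map_neg, LinearMap.neg_apply, hy]
    rw [hf, map_smul, map_sub, h1, hy, smul_eq_mul]
    field_simp
    norm_num
  have hfe : ω f e = -1 := by rw [h.swap, hef]
  have hgf := hmem.1 hfW
  have hspan : ∀ x ∈ W, planeProj ω e f x = x := by
    have hli : LinearIndependent F ![(⟨e, he⟩ : W), ⟨f, hfW⟩] := by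
      rw [LinearIndependent.pair_iff]
      intro s t hst
      have hst' : s • e + t • f = 0 := congrArg Subtype.val hst
      have h1 := congrArg (fun v => ω v f) hst'
      have h3 := congrArg (fun v => ω v e) hst'
      simp [hef, hfe, h.self] at h1 h3
      exact ⟨h1, h3⟩
    let b := basisOfLinearIndependentOfCardEqFinrank hli (by simp [hfin])
    intro x hx
    have hx' := b.sum_repr ⟨x, hx⟩
    rw [Fin.sum_univ_two] at hx'
    simp only [b, coe_basisOfLinearIndependentOfCardEqFinrank, Matrix.cons_val_zero,
      Matrix.cons_val_one] at hx'
    have hx'' := congrArg Subtype.val hx'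
    simp only [Submodule.coe_add, Submodule.coe_smul] at hx''
    rw [← hx'']
    simp [planeProj_apply, hef, hfe, h.self]
  refine ⟨e, f, hef, isometryGroup.ext fun x => ?_⟩
  have hxW : x - g.1 x ∈ W := by
    rw [hmem, map_sub, hg2]
    module
  have h1 := hspan _ hxW
  have h3 : ω (g.1 x) e = -ω x e := by rw [hadj, hge, map_neg]
  have h4 : ω (g.1 x) f = -ω x f := by rw [hadj, hgf, map_neg]
  have h5 : (2 : F) • planeProj ω e f x = x - g.1 x := by
    rw [← h1, planeProj_apply, planeProj_apply, map_sub, LinearMap.sub_apply,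
      LinearMap.sub_apply, h3, h4]
    module
  rw [planeInv_apply, h5, sub_sub_cancel]

/-- An isometry of order two whose `(-1)`-eigenspace has dimension or codimension two is, up to
sign, the involution of a hyperbolic pair. -/
theorem exists_eq_planeInv_or (h : IsSymplecticForm ω) (h2 : (2 : F) ≠ 0)
    (hV : 2 ≤ finrank F V) {g : isometryGroup ω} (hgg : g * g = 1)
    (hfin : finrank F (Module.End.eigenspace g.1.toLinearMap (-1)) = 2 ∨
      finrank F (Module.End.eigenspace g.1.toLinearMap (-1)) = finrank F V - 2) :
    ∃ (e f : V) (hef : ω e f = 1), g = h.planeInv hef ∨ g = negOne ω * h.planeInv hef := by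
  rcases hfin with hfin | hfin
  · obtain ⟨e, f, hef, hg⟩ := h.exists_eq_planeInv h2 hgg hfin
    exact ⟨e, f, hef, Or.inl hg⟩
  have hg2 : ∀ x, g.1 (g.1 x) = x := fun x => by rw [← mul_apply, hgg, one_apply]
  have hkk : (negOne ω * g) * (negOne ω * g) = 1 := by
    rw [mul_assoc, ← mul_assoc g, ← negOne_comm, mul_assoc, hgg, mul_one, negOne_mul_self]
  -- the two eigenspaces of `g` are complementary and `-1` exchanges them
  have hfin' : finrank F (Module.End.eigenspace (negOne ω * g).1.toLinearMap (-1)) = 2 := by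
    have hcompl : IsCompl (Module.End.eigenspace (negOne ω * g).1.toLinearMap (-1))
        (Module.End.eigenspace g.1.toLinearMap (-1)) := by
      have h1 : ∀ x, x ∈ Module.End.eigenspace (negOne ω * g).1.toLinearMap (-1) ↔
          g.1 x = x := by
        intro x
        rw [Module.End.mem_eigenspace_iff]
        simp
      have h3 : ∀ x, x ∈ Module.End.eigenspace g.1.toLinearMap (-1) ↔ g.1 x = -x := by
        intro x
        rw [Module.End.mem_eigenspace_iff]
        simp
      constructor
      · rw [Submodule.disjoint_def]
        intro x hx hx'
        have h4 := ((h1 x).1 hx).symm.trans ((h3 x).1 hx')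
        rw [eq_neg_iff_add_eq_zero, ← two_smul F] at h4
        exact (smul_eq_zero_iff_right h2).1 h4
      · rw [codisjoint_iff, eq_top_iff]
        intro x _
        rw [Submodule.mem_sup]
        refine ⟨(2 : F)⁻¹ • (x + g.1 x), (h1 _).2 ?_, (2 : F)⁻¹ • (x - g.1 x), (h3 _).2 ?_, ?_⟩
        · rw [map_smul, map_add, hg2, add_comm]
        · rw [map_smul, map_sub, hg2]
          module
        · rw [← smul_add, add_add_sub_cancel, ← two_smul F, smul_smul, inv_mul_cancel₀ h2,
            one_smul]
    have := Submodule.finrank_add_eq_of_isCompl hcompl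
    omega
  obtain ⟨e, f, hef, hg⟩ := h.exists_eq_planeInv h2 hkk hfin'
  refine ⟨e, f, hef, Or.inr ?_⟩
  rw [← hg, ← mul_assoc, negOne_mul_self, one_mul]

end Matrices

/-- The bilinear form with matrix `J` is symplectic. -/
theorem toBilin'_J (n : ℕ) (F : Type*) [Field F] :
    IsSymplecticForm (Matrix.toBilin' (Matrix.J (Fin n) F)) := by
  have hform : ∀ x y : Fin n ⊕ Fin n → F, Matrix.toBilin' (Matrix.J (Fin n) F) x y =
      ∑ i, (x (Sum.inr i) * y (Sum.inl i) - x (Sum.inl i) * y (Sum.inr i)) := by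
    intro x y
    rw [Matrix.toBilin'_apply', Matrix.J, Matrix.fromBlocks_mulVec]
    simp [dotProduct, Fintype.sum_sum_type, Finset.sum_sub_distrib, Matrix.neg_mulVec]
    ring
  constructor
  · intro x
    rw [hform]
    exact Finset.sum_eq_zero fun i _ => by ring
  · intro x hx
    ext i
    rcases i with i | i
    · have h1 := hx (Pi.single (Sum.inr i) 1)
      rw [hform] at h1
      simpa [Pi.single_apply] using h1
    · have h1 := hx (Pi.single (Sum.inl i) 1)
      rw [hform] at h1
      simpa [Pi.single_apply] using h1

/-- The symplectic matrix group as the isometry group of a symplectic form, with involutions of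
type `t_1` corresponding, up to sign, to plane involutions. -/
theorem exists_isometryGroup_mulEquiv {n : ℕ} (hn : 1 ≤ n) {F : Type*} [Field F]
    (h2 : (2 : F) ≠ 0) :
    ∃ (ω : LinearMap.BilinForm F (Fin n ⊕ Fin n → F)) (h : IsSymplecticForm ω)
      (Ψ : isometryGroup ω ≃* Sp2n n F), ∀ i : Sp2n n F, Sp2n.IsTypeT1 i →
        ∃ (e f : Fin n ⊕ Fin n → F) (hef : ω e f = 1),
          i = Ψ (h.planeInv hef) ∨ i = Ψ (negOne ω) * Ψ (h.planeInv hef) := by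
  have h := toBilin'_J n F
  have hb : LinearMap.BilinForm.toMatrix (Pi.basisFun F (Fin n ⊕ Fin n))
      (Matrix.toBilin' (Matrix.J (Fin n) F)) = Matrix.J (Fin n) F := by
    rw [LinearMap.BilinForm.toMatrix_basisFun, LinearMap.BilinForm.toMatrix'_toBilin']
  obtain ⟨Ψ, hΨ⟩ := h.exists_mulEquiv_of_basis _ hb
  refine ⟨_, h, Ψ, ?_⟩
  intro i hi
  obtain ⟨g, rfl⟩ := Ψ.surjective i
  obtain ⟨ho, hfin⟩ := hi
  have hgg : g * g = 1 := by
    have h1 := pow_orderOf_eq_one (Ψ g)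
    rw [ho, sq, ← map_mul] at h1
    exact (MulEquiv.map_eq_one_iff Ψ).1 h1
  have hlin : Matrix.toLin' (Ψ g : Matrix (Fin n ⊕ Fin n) (Fin n ⊕ Fin n) F) =
      g.1.toLinearMap := by
    rw [hΨ, ← Matrix.toLin_eq_toLin', Matrix.toLin_toMatrix]
  have hV : finrank F (Fin n ⊕ Fin n → F) = 2 * n := by
    simp
    ring
  rw [hlin] at hfin
  rw [← hV] at hfin
  obtain ⟨e, f, hef, hg⟩ := h.exists_eq_planeInv_or h2 (by omega) hgg hfin
  refine ⟨e, f, hef, ?_⟩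
  rcases hg with hg | hg
  · exact Or.inl (congrArg Ψ hg)
  · right
    rw [hg, map_mul]

/-- The heart is insensitive to a change of sign of the involution. -/
theorem heart_map_eq {F V : Type*} [Field F] [AddCommGroup V] [Module F V]
    {ω : LinearMap.BilinForm F V} {G : Type*} [Group G] (π : isometryGroup ω →* G)
    (hπ : Function.Surjective π) {i : G} {t : isometryGroup ω}
    (hi : i = π t ∨ i = π (negOne ω) * π t) : heart i = heart (π t) := by
  rcases hi with rfl | rfl
  · rfl
  · refine heart_central_mul (Subgroup.mem_center_iff.2 fun x => ?_) ?_
    · obtain ⟨y, rfl⟩ := hπ x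
      rw [← map_mul, ← map_mul, negOne_comm]
    · rw [← map_mul, negOne_mul_self, map_one]

/-- A group isomorphic to the projective symplectic group is the quotient of the isometry group
by `±1`, and its involutions of type `t_1` are the images of plane involutions. -/
theorem exists_hom_of_isTypeT1 {n : ℕ} {F : Type*} [Field F] {V : Type*} [AddCommGroup V]
    [Module F V] [FiniteDimensional F V] {ω : LinearMap.BilinForm F V} (h : IsSymplecticForm ω)
    (h2 : (2 : F) ≠ 0) (Ψ : isometryGroup ω ≃* Sp2n n F)
    (hT : ∀ i : Sp2n n F, Sp2n.IsTypeT1 i → ∃ (e f : V) (hef : ω e f = 1),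
      i = Ψ (h.planeInv hef) ∨ i = Ψ (negOne ω) * Ψ (h.planeInv hef))
    {G : Type*} [Group G] (φ : G ≃* PSp2n n F) {i : G} (hi : PSp2n.IsTypeT1 (φ i)) :
    ∃ π : isometryGroup ω →* G, Function.Surjective π ∧
      (∀ g, π g = 1 ↔ g = 1 ∨ g = negOne ω) ∧
      ∃ (e f : V) (hef : ω e f = 1), i = π (h.planeInv hef) := by
  let π : isometryGroup ω →* G :=
    φ.symm.toMonoidHom.comp ((QuotientGroup.mk' _).comp Ψ.toMonoidHom)
  have hπx : ∀ g, π g = φ.symm (QuotientGroup.mk (Ψ g)) := fun g => rfl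
  have hker : ∀ g, π g = 1 ↔ g = 1 ∨ g = negOne ω := by
    intro g
    rw [hπx, MulEquiv.map_eq_one_iff, QuotientGroup.eq_one_iff, ← h.mem_center_iff h2]
    exact MulEquivClass.apply_mem_center_iff Ψ
  refine ⟨π, ?_, hker, ?_⟩
  · exact φ.symm.surjective.comp ((QuotientGroup.mk'_surjective _).comp Ψ.surjective)
  · obtain ⟨-, j, hj, hji⟩ := hi
    obtain ⟨e, f, hef, hj'⟩ := hT j hj
    have hij : i = φ.symm (QuotientGroup.mk j) := φ.eq_symm_apply.2 hji.symm
    refine ⟨e, f, hef, ?_⟩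
    rcases hj' with rfl | rfl
    · exact hij
    · rw [← map_mul, ← hπx, map_mul, (hker _).2 (Or.inr rfl), one_mul] at hij
      exact hij

end IsSymplecticForm

theorem two_ne_zero_of_odd_natCard {F : Type*} [Field F] [Finite F] (hodd : Odd (Nat.card F)) :
    (2 : F) ≠ 0 := by
  have := Fintype.ofFinite F
  rw [Nat.card_eq_fintype_card, Nat.odd_iff] at hodd
  refine Ring.two_ne_zero fun hchar => ?_
  have := FiniteField.even_card_iff_char_two.1 hchar
  omega

theorem exists_sq_ne_one_of_three_lt_natCard {F : Type*} [Field F] [Finite F]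
    (hq : 3 < Nat.card F) : ∃ c : F, c ≠ 0 ∧ c ^ 2 ≠ 1 := by
  classical
  have := Fintype.ofFinite F
  rw [Nat.card_eq_fintype_card] at hq
  have hcard : ({0, 1, -1} : Finset F).card < Fintype.card F := Finset.card_le_three.trans_lt hq
  obtain ⟨c, -, hc⟩ := Finset.exists_mem_notMem_of_card_lt_card
    (s := ({0, 1, -1} : Finset F)) (t := Finset.univ) (by simpa using hcard)
  simp only [Finset.mem_insert, Finset.mem_singleton, not_or] at hc
  refine ⟨c, hc.1, fun h1 => ?_⟩
  rw [sq, mul_self_eq_one_iff] at h1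
  exact h1.elim hc.2.1 hc.2.2

open IsSymplecticForm isometryGroup in
theorem mainTheorem8 {F : Type*} [Field F] [Finite F]
    (hodd : Odd (Nat.card F)) (hq : 3 < Nat.card F) :
    -- (a) the derived subgroup of the heart in rank at least three
    (∀ (n : ℕ), 3 ≤ n →
      (∀ {G : Type*} [Group G] (e : G ≃* Sp2n n F) (i : G), Sp2n.IsTypeT1 (e i) →
        Nonempty ((⁅heart i, heart i⁆ : Subgroup G) ≃* Sp2n (n - 1) F)) ∧
      (∀ {G : Type*} [Group G] (e : G ≃* PSp2n n F) (i : G), PSp2n.IsTypeT1 (e i) →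
        Nonempty ((⁅heart i, heart i⁆ : Subgroup G) ≃* Sp2n (n - 1) F))) ∧
    -- (b) the four-dimensional symplectic group
    (∀ {G : Type*} [Group G] (e : G ≃* Sp2n 2 F) (i : G), Sp2n.IsTypeT1 (e i) →
      heart i = Subgroup.center G) ∧
    -- (c) the four-dimensional projective symplectic group
    (∀ {G : Type*} [Group G] (e : G ≃* PSp2n 2 F) (i : G), PSp2n.IsTypeT1 (e i) →
      (semisimpleSocle (Subgroup.centralizer {i})).map (Subgroup.centralizer {i}).subtype
        ≤ heart i) := by
  have h2 := two_ne_zero_of_odd_natCard hodd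
  obtain ⟨c, hc0, hc⟩ := exists_sq_ne_one_of_three_lt_natCard hq
  have hdim : ∀ n : ℕ, finrank F (Fin n ⊕ Fin n → F) = 2 * n := fun n => by
    simp
    ring
  refine ⟨fun n hn => ?_, ?_, ?_⟩
  · obtain ⟨ω, h, Ψ, hT⟩ := exists_isometryGroup_mulEquiv (by omega : 1 ≤ n) h2
    have hV : 5 ≤ finrank F (Fin n ⊕ Fin n → F) := by
      rw [hdim]
      omega
    constructor
    · intro G _ e i hi
      obtain ⟨x, y, hxy, hi'⟩ := hT _ hi
      have hheart : heart i = heart ((Ψ.trans e.symm).toMonoidHom (h.planeInv hxy)) := by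
        refine heart_map_eq _ (Ψ.trans e.symm).surjective (hi'.imp (fun h1 => ?_) fun h1 => ?_)
        · exact e.eq_symm_apply.2 h1
        · refine (e.eq_symm_apply.2 h1).trans (map_mul _ _ _)
      rw [hheart]
      obtain ⟨a⟩ := h.nonempty_commutator_heart_equiv_fixer h2 hV hc0 hc hxy
        (Ψ.trans e.symm).toMonoidHom (Ψ.trans e.symm).surjective
        fun g hg => Or.inl ((MulEquiv.map_eq_one_iff (Ψ.trans e.symm)).1 hg)
      obtain ⟨b⟩ := h.nonempty_fixer_equiv (hdim n) hxy
      exact ⟨a.trans b⟩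
    · intro G _ e i hi
      obtain ⟨π, hπ, hker, x, y, hxy, hi'⟩ := exists_hom_of_isTypeT1 h h2 Ψ hT e hi
      rw [hi']
      obtain ⟨a⟩ := h.nonempty_commutator_heart_equiv_fixer h2 hV hc0 hc hxy π hπ
        fun g hg => (hker g).1 hg
      obtain ⟨b⟩ := h.nonempty_fixer_equiv (hdim n) hxy
      exact ⟨a.trans b⟩
  · intro G _ e i hi
    obtain ⟨ω, h, Ψ, hT⟩ := exists_isometryGroup_mulEquiv (n := 2) (by norm_num) h2
    obtain ⟨x, y, hxy, hi'⟩ := hT _ hi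
    have hheart : heart i = heart ((Ψ.trans e.symm) (h.planeInv hxy)) := by
      refine heart_map_eq (Ψ.trans e.symm).toMonoidHom (Ψ.trans e.symm).surjective
        (hi'.imp (fun h1 => ?_) fun h1 => ?_)
      · exact e.eq_symm_apply.2 h1
      · exact (e.eq_symm_apply.2 h1).trans (map_mul _ _ _)
    rw [hheart, ← map_heart_mulEquiv, h.heart_planeInv_eq_center h2 (hdim 2) hxy]
    ext g
    constructor
    · rintro ⟨k, hk, rfl⟩
      exact (MulEquivClass.apply_mem_center_iff (Ψ.trans e.symm)).2 hk
    · intro hg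
      obtain ⟨k, rfl⟩ := (Ψ.trans e.symm).surjective g
      exact ⟨k, (MulEquivClass.apply_mem_center_iff (Ψ.trans e.symm)).1 hg, rfl⟩
  · intro G _ e i hi
    obtain ⟨ω, h, Ψ, hT⟩ := exists_isometryGroup_mulEquiv (n := 2) (by norm_num) h2
    obtain ⟨π, hπ, hker, x, y, hxy, hi'⟩ := exists_hom_of_isTypeT1 h h2 Ψ hT e hi
    rw [hi']
    exact h.semisimpleSocle_le_heart h2 (hdim 2) hc0 hc hxy π hπ hker
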